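/- Let $n\ge 1$, $\mathbb{K}\in\{\mathbb{R},\mathbb{C}\}$, $s\in(0,1)$ and $1\le p,q\le\infty$. All functions are $\mathbb{K}$-valued on $\mathbb{R}^n$ and are identified when they agree almost everywhere. Write $\Delta_hf(x)=f(x+h)-f(x)$ and $\omega_p(t,f)=\sup_{|h|\le t}\|\Delta_hf\|_{L^p}$. For $f\in L^1_{\mathrm{loc}}(\mathbb{R}^n;\mathbb{K})$ and a constant $\sigma>0$ put $$[f]^{(\sigma)}_{\tilde B^{s,p}_q}=\Big(\int_{B(0,\sigma)}\big(|h|^{-s}\|\Delta_hf\|_{L^p}\big)^q|h|^{-n}\,dh\Big)^{1/q},\qquad [f]_{\dot B^{s,p}_q}=\Big(\int_0^\infty\big(t^{-s}\omega_p(t,f)\big)^q\,\frac{dt}{t}\Big)^{1/q}$$ if $q<\infty$, and, if $q=\infty$, $[f]^{(\sigma)}_{\tilde B^{s,p}_\infty}=\operatorname{ess\,sup}_{h\in B(0,\sigma)}|h|^{-s}\|\Delta_hf\|_{L^p}$ and $[f]_{\dot B^{s,p}_\infty}=\sup_{t>0}t^{-s}\omega_p(t,f)$. The screened Besov space ${}_{(\sigma)}\tilde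 B^{s,p}_q$ and the homogeneous Besov space $\dot B^{s,p}_q$ consist of the $f\in L^1_{\mathrm{loc}}$ for which the respective quantity is finite; $\tilde B^{s,p}_q$ denotes ${}_{(1)}\tilde B^{s,p}_q$. The homogeneous Sobolev space $\dot W^{1,p}$ consists of the $f\in L^1_{\mathrm{loc}}$ whose weak partial derivatives $\partial_1f,\dots,\partial_nf$ all belong to $L^p$, with seminorm $[f]_{\dot W^{1,p}}=\sum_{j=1}^n\|\partial_jf\|_{L^p}$. The sum $\Sigma(X_0,X_1)=\{f_0+f_1: f_0\in X_0,\ f_1\in X_1\}$ of two such spaces carries the seminorm $[f]_\Sigma=\inf\{[f_0]_{X_0}+[f_1]_{X_1}: f=f_0+f_1,\ f_i\in X_i\}$. 1. For all constants $\sigma,\tau>0$, $${}_{(\sigma)}\tilde B^{s,p}_q(\mathbb{R}^n;\mathbb{K})=\Sigma\big(\dot B^{s,p}_q(\mathbb{R}^n;\mathbb{K}),\dot W^{1,p}(\mathbb{R}^n;\mathbb{K})\big)={}_{(\tau)}\tilde B^{s,p}_q(\mathbb{R}^n;\mathbb{K})$$ as vector spaces, with equivalent seminorms. 2. Suppose that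 $p<\infty$ and that $\sigma:\mathbb{R}^n\to(0,\infty)$ is a lower semicontinuous function such that $\log\sigma$ is bounded. Let the screened Sobolev space $\tilde W^{s,p}_{(\sigma)}(\mathbb{R}^n;\mathbb{K})$ consist of the $f\in L^1_{\mathrm{loc}}$ for which $$[f]_{\tilde W^{s,p}_{(\sigma)}}=\Big(\int_{\mathbb{R}^n}\int_{B(x,\sigma(x))}|f(x)-f(y)|^p|x-y|^{-n-sp}\,dy\,dx\Big)^{1/p}<\infty .$$ Then $$\tilde W^{s,p}_{(\sigma)}(\mathbb{R}^n;\mathbb{K})=\Sigma\big(\dot B^{s,p}_p(\mathbb{R}^n;\mathbb{K}),\dot W^{1,p}(\mathbb{R}^n;\mathbb{K})\big)=\tilde B^{s,p}_p(\mathbb{R}^n;\mathbb{K})$$ as vector spaces, with equivalent seminorms. -/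

import Mathlib

open MeasureTheory Metric
open scoped ENNReal NNReal ContDiff

noncomputable section

/-- A seminormed space of locally integrable `𝕜`-valued functions on `ℝⁿ`, recorded by its
underlying set of functions and by its seminorm (extended to all functions, with values in
`[0, ∞]`; only the values on `carrier` matter). Functions are representatives of almost everywhere
classes: every notion below is invariant under modification on a null set. -/
structure FunctionSpace (n : ℕ) (𝕜 : Type*) [RCLike 𝕜] where
  carrier : Set (EuclideanSpace ℝ (Fin n) → 𝕜)
  seminorm : (EuclideanSpace ℝ (Fin n) → 𝕜) → ℝ≥0∞

namespace FunctionSpace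

variable {n : ℕ} {𝕜 : Type*} [RCLike 𝕜]

/-- The subspace of `L¹_loc(ℝⁿ; 𝕜)` on which the extended seminorm `N` is finite. -/
def ofSeminorm (N : (EuclideanSpace ℝ (Fin n) → 𝕜) → ℝ≥0∞) : FunctionSpace n 𝕜 where
  carrier := {f | LocallyIntegrable f volume ∧ N f < ⊤}
  seminorm := N

/-- The sum `Σ(X₀, X₁)` with the seminorm
`[f]_Σ = inf {[f₀]₀ + [f₁]₁ : f₀ ∈ X₀, f₁ ∈ X₁, f = f₀ + f₁}`, the equality `f = f₀ + f₁` being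
that of elements of `L¹_loc`, i.e. almost everywhere. -/
def sum (X₀ X₁ : FunctionSpace n 𝕜) : FunctionSpace n 𝕜 where
  carrier := {f | ∃ f₀ ∈ X₀.carrier, ∃ f₁ ∈ X₁.carrier, f =ᵐ[volume] f₀ + f₁}
  seminorm f := ⨅ (f₀ ∈ X₀.carrier) (f₁ ∈ X₁.carrier) (_ : f =ᵐ[volume] f₀ + f₁),
    X₀.seminorm f₀ + X₁.seminorm f₁

/-- Equality of spaces with equivalence of seminorms. -/
def Equivalent (X Y : FunctionSpace n 𝕜) : Prop :=
  X.carrier = Y.carrier ∧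
    ∃ C : ℝ≥0, 0 < C ∧ ∀ f ∈ X.carrier,
      X.seminorm f ≤ C * Y.seminorm f ∧ Y.seminorm f ≤ C * X.seminorm f

end FunctionSpace

section Spaces

variable {n : ℕ} {𝕜 : Type*} [RCLike 𝕜]

/-- The forward difference `Δ_h f (x) = f (x + h) - f x`. -/
def forwardDiff (h : EuclideanSpace ℝ (Fin n)) (f : EuclideanSpace ℝ (Fin n) → 𝕜) :
    EuclideanSpace ℝ (Fin n) → 𝕜 :=
  fun x => f (x + h) - f x

/-- The `Lᵖ`-modulus of continuity `ω_p(t, f) = sup {‖Δ_h f‖_{Lᵖ} : |h| ≤ t}`. -/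
def modulusOfContinuity (p : ℝ≥0∞) (t : ℝ) (f : EuclideanSpace ℝ (Fin n) → 𝕜) : ℝ≥0∞ :=
  ⨆ h ∈ closedBall (0 : EuclideanSpace ℝ (Fin n)) t, eLpNorm (forwardDiff h f) p volume

/-- The homogeneous Besov seminorm: the `L^q((0, ∞), dt/t)` norm of `t ↦ t^{-s} ω_p(t, f)`. -/
def homogeneousBesovSeminorm (s : ℝ) (p q : ℝ≥0∞) (f : EuclideanSpace ℝ (Fin n) → 𝕜) : ℝ≥0∞ :=
  if q = ⊤ then
    ⨆ t ∈ Set.Ioi (0 : ℝ), ENNReal.ofReal (t ^ (-s)) * modulusOfContinuity p t f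
  else
    (∫⁻ t in Set.Ioi (0 : ℝ),
      (ENNReal.ofReal (t ^ (-s)) * modulusOfContinuity p t f) ^ q.toReal
        * ENNReal.ofReal t⁻¹) ^ (1 / q.toReal)

/-- The screened Besov seminorm with constant screening `σ`: the `L^q(B(0, σ), dh/|h|ⁿ)` norm of
`h ↦ |h|^{-s} ‖Δ_h f‖_{Lᵖ}`. -/
def screenedBesovSeminorm (σ s : ℝ) (p q : ℝ≥0∞) (f : EuclideanSpace ℝ (Fin n) → 𝕜) : ℝ≥0∞ :=
  if q = ⊤ then
    essSup (fun h : EuclideanSpace ℝ (Fin n) =>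
      ENNReal.ofReal (‖h‖ ^ (-s)) * eLpNorm (forwardDiff h f) p volume)
      (volume.restrict (ball 0 σ))
  else
    (∫⁻ h in ball (0 : EuclideanSpace ℝ (Fin n)) σ,
      (ENNReal.ofReal (‖h‖ ^ (-s)) * eLpNorm (forwardDiff h f) p volume) ^ q.toReal
        * ENNReal.ofReal (‖h‖ ^ (-(n : ℝ)))) ^ (1 / q.toReal)

/-- The screened Sobolev seminorm with screening function `σ`, for `1 ≤ p < ∞`. -/
def screenedSobolevSeminorm (σ : EuclideanSpace ℝ (Fin n) → ℝ) (s : ℝ) (p : ℝ)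
    (f : EuclideanSpace ℝ (Fin n) → 𝕜) : ℝ≥0∞ :=
  (∫⁻ x, ∫⁻ y in ball x (σ x),
    ENNReal.ofReal (‖f x - f y‖ ^ p * ‖x - y‖ ^ (-(n : ℝ) - s * p))) ^ (1 / p)

/-- `g` is the `j`-th weak partial derivative of `f`: both are locally integrable and
`∫ f ∂_jφ = - ∫ g φ` for all test functions `φ ∈ C_c^∞(ℝⁿ)`. -/
def IsWeakPartial (j : Fin n) (f g : EuclideanSpace ℝ (Fin n) → 𝕜) : Prop :=
  LocallyIntegrable f volume ∧ LocallyIntegrable g volume ∧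
    ∀ φ : EuclideanSpace ℝ (Fin n) → ℝ, ContDiff ℝ ∞ φ → HasCompactSupport φ →
      ∫ x, (fderiv ℝ φ x (EuclideanSpace.single j 1)) • f x = - ∫ x, φ x • g x

/-- The homogeneous Sobolev seminorm `∑_j ‖∂_j f‖_{Lᵖ}`. Weak derivatives are unique almost
everywhere, so the infimum runs over a single value; it is `∞` if some weak partial derivative
does not exist. -/
def homogeneousSobolevSeminorm (p : ℝ≥0∞) (f : EuclideanSpace ℝ (Fin n) → 𝕜) : ℝ≥0∞ :=
  ⨅ (g : Fin n → EuclideanSpace ℝ (Fin n) → 𝕜) (_ : ∀ j, IsWeakPartial j f (g j)),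
    ∑ j, eLpNorm (g j) p volume

end Spaces

/-- The homogeneous Sobolev space `Ẇ^{1,p}(ℝⁿ; 𝕜)`: the locally integrable functions all of whose
weak partial derivatives belong to `Lᵖ`. -/
def homogeneousSobolev (n : ℕ) (𝕜 : Type*) [RCLike 𝕜] (p : ℝ≥0∞) : FunctionSpace n 𝕜 where
  carrier := {f | LocallyIntegrable f volume ∧ ∀ j, ∃ g, IsWeakPartial j f g ∧ MemLp g p volume}
  seminorm := homogeneousSobolevSeminorm p

/-- The homogeneous Besov space `Ḃ^{s,p}_q(ℝⁿ; 𝕜)`. -/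
def homogeneousBesov (n : ℕ) (𝕜 : Type*) [RCLike 𝕜] (s : ℝ) (p q : ℝ≥0∞) : FunctionSpace n 𝕜 :=
  FunctionSpace.ofSeminorm (homogeneousBesovSeminorm s p q)

/-- The screened Besov space `_{(σ)}B̃^{s,p}_q(ℝⁿ; 𝕜)` with constant screening `σ`. -/
def screenedBesov (n : ℕ) (𝕜 : Type*) [RCLike 𝕜] (σ s : ℝ) (p q : ℝ≥0∞) : FunctionSpace n 𝕜 :=
  FunctionSpace.ofSeminorm (screenedBesovSeminorm σ s p q)

/-- The screened Sobolev space `W̃^{s,p}_{(σ)}(ℝⁿ; 𝕜)` with screening function `σ`. -/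
def screenedSobolev (n : ℕ) (𝕜 : Type*) [RCLike 𝕜] (σ : EuclideanSpace ℝ (Fin n) → ℝ)
    (s p : ℝ) : FunctionSpace n 𝕜 :=
  FunctionSpace.ofSeminorm (screenedSobolevSeminorm σ s p)

/-- A (finite) screening function on `ℝⁿ`: positive and lower semicontinuous. -/
structure IsScreening {n : ℕ} (σ : EuclideanSpace ℝ (Fin n) → ℝ) : Prop where
  pos : ∀ x, 0 < σ x
  lowerSemicontinuous : LowerSemicontinuous σ

end

/-! The screened norm sees only shifts `|h| < σ`, and at such shifts an `Ẇ^{1,p}` function is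
harmless. If `f = f₀ + f₁`, then `‖Δ_h f‖_p ≤ ω_p(|h|, f₀) + |h| ∑ ‖∂_j f₁‖_p`. The first term gives
the homogeneous Besov norm in polar coordinates. The second gives the weight `t^{(1-s)q-1}` on `(0,
σ)`, integrable because `s < 1`; for `q = ∞` it gives the bound `σ^{1-s}`. This is
`exists_screenedBesovSeminorm_le`.

Conversely, put `T = σ/2` and mollify at scale `T`: `f₁ = ρ * f` and `f₀ = f - ρ * f`
(`exists_rough_smooth_decomposition`). Since `∫ ρ = 1` and `∫ ∂_j ρ = 0`, both `f₀` and `∂_j f₁` are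
averages of differences of `f` over shifts of length at most `T`, so their `L^p` norms are at most a
constant times `ω_p(T, f)`. Hence `ω_p(t, f₀)` is bounded by a multiple of `ω_p(t, f)` for `t ≤ T`
and of `ω_p(T, f)` for all `t`; the tail converges because `s > 0`.

It remains to bound the supremum `ω_p` by the integral over shifts. Writing `h = y + (h - y)` and
averaging over `|y| < t` bounds `ω_p(t, f)` by a mean of `‖Δ_y f‖_p` over `|y| < 2t`
(`volume_ball_mul_modulusOfContinuity_le`). Jensen and Tonelli then give the weighted estimates on
`B(0, 2T) = B(0, σ)`.

For part 2, Tonelli identifies the Sobolev and Besov norms under constant screening, and a variable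
`σ` lies between the constants `e^{-M}` and `e^M`, which both give the same sum space. -/

/-- The Euclidean space `ℝⁿ`. -/
abbrev Euc (n : ℕ) := EuclideanSpace ℝ (Fin n)

/-! ### Measurability and averaging inequalities for `L^p` norms. -/

section Lp

variable {α β : Type*} [MeasurableSpace α] [MeasurableSpace β]

theorem measurable_eLpNorm_section {F : Type*} [NormedAddCommGroup F] [MeasurableSpace F]
    [OpensMeasurableSpace F] {μ : Measure α} [SFinite μ] {f : β → α → F}
    (hf : Measurable (Function.uncurry f)) (p : ℝ≥0∞) :
    Measurable fun b => eLpNorm (f b) p μ := by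
  rcases eq_or_ne p 0 with rfl | h0
  · simp
  rcases eq_or_ne p ⊤ with rfl | ht
  · simp only [eLpNorm_exponent_top, eLpNormEssSup]
    refine measurable_of_Ioi fun c => ?_
    have hS : MeasurableSet {z : β × α | c < ‖Function.uncurry f z‖ₑ} :=
      measurableSet_lt measurable_const hf.enorm
    -- The essential supremum exceeds `c` exactly when the slice of the superlevel set has positive
    -- measure, and slice measures are measurable in `b`.
    have key : (fun b => essSup (fun x => ‖f b x‖ₑ) μ) ⁻¹' Set.Ioi c =
        {b | μ (Prod.mk b ⁻¹' {z : β × α | c < ‖Function.uncurry f z‖ₑ}) ≠ 0} := by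
      ext b
      have hle : essSup (fun x => ‖f b x‖ₑ) μ ≤ c ↔ ∀ᵐ x ∂μ, ‖f b x‖ₑ ≤ c :=
        ⟨fun h => (ENNReal.ae_le_essSup _).mono fun x hx => hx.trans h,
          fun h => essSup_le_of_ae_le _ h⟩
      rw [Set.mem_preimage, Set.mem_Ioi, ← not_le, hle, ae_iff]
      simp [Function.uncurry, Set.preimage]
    rw [key]
    exact (measurable_measure_prodMk_left hS) (measurableSet_singleton 0).compl
  · simp only [eLpNorm_eq_lintegral_rpow_enorm_toReal h0 ht]
    exact (Measurable.lintegral_prod_right' (f := fun z => ‖Function.uncurry f z‖ₑ ^ p.toReal)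
      (hf.enorm.pow_const _)).pow_const _

/-- Jensen's inequality for powers and a finite measure. -/
theorem lintegral_rpow_le_measure_univ_rpow_mul {ν : Measure β} [IsFiniteMeasure ν]
    {f : β → ℝ≥0∞} (hf : AEMeasurable f ν) {r : ℝ} (hr : 1 ≤ r) :
    (∫⁻ y, f y ∂ν) ^ r ≤ ν Set.univ ^ (r - 1) * ∫⁻ y, f y ^ r ∂ν := by
  rcases hr.eq_or_lt with rfl | hr
  · simp
  have hc : r.HolderConjugate (r / (r - 1)) := Real.HolderConjugate.conjExponent hr
  have h := ENNReal.lintegral_mul_le_Lp_mul_Lq ν hc hf (aemeasurable_const (b := (1 : ℝ≥0∞)))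
  simp only [Pi.mul_apply, mul_one, ENNReal.one_rpow, lintegral_const, one_mul] at h
  have hr0 : 0 < r := by linarith
  calc (∫⁻ y, f y ∂ν) ^ r
      ≤ ((∫⁻ y, f y ^ r ∂ν) ^ (1 / r) * ν Set.univ ^ (1 / (r / (r - 1)))) ^ r := by gcongr
    _ = ν Set.univ ^ (r - 1) * ∫⁻ y, f y ^ r ∂ν := by
      rw [ENNReal.mul_rpow_of_nonneg _ _ hr0.le, ← ENNReal.rpow_mul, ← ENNReal.rpow_mul, mul_comm]
      congr 2
      · field_simp
      · rw [one_div_mul_cancel hr0.ne', ENNReal.rpow_one]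

/-- The `Lᵖ` norm of an average is at most the supremum of the `Lᵖ` norms. -/
theorem eLpNorm_lintegral_le {μ : Measure α} [SFinite μ] {ν : Measure β} [IsFiniteMeasure ν]
    {p : ℝ≥0∞} (hp : 1 ≤ p) {F : α → β → ℝ≥0∞} (hF : Measurable (Function.uncurry F))
    {K : ℝ≥0∞} (hK : ∀ᵐ y ∂ν, eLpNorm (fun x => F x y) p μ ≤ K) :
    eLpNorm (fun x => ∫⁻ y, F x y ∂ν) p μ ≤ ν Set.univ * K := by
  have h0 : p ≠ 0 := (zero_lt_one.trans_le hp).ne'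
  rcases eq_or_ne p ⊤ with rfl | ht
  · simp only [eLpNorm_exponent_top, eLpNormEssSup, enorm_eq_self] at hK ⊢
    have h1 : ∀ᵐ y ∂ν, ∀ᵐ x ∂μ, F x y ≤ K := hK.mono fun y hy =>
      (ENNReal.ae_le_essSup _).mono fun x hx => hx.trans hy
    have h2 : ∀ᵐ x ∂μ, ∀ᵐ y ∂ν, F x y ≤ K := by
      rwa [Measure.ae_ae_comm]
      exact measurableSet_le hF measurable_const
    refine essSup_le_of_ae_le _ (h2.mono fun x hx => ?_)
    calc ∫⁻ y, F x y ∂ν ≤ ∫⁻ _, K ∂ν := lintegral_mono_ae hx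
      _ = ν Set.univ * K := by rw [lintegral_const, mul_comm]
  · have hr : 1 ≤ p.toReal := by
      simpa using ENNReal.toReal_mono ht hp
    have hr0 : 0 < p.toReal := by linarith
    simp only [eLpNorm_eq_lintegral_rpow_enorm_toReal h0 ht, enorm_eq_self] at hK ⊢
    rw [one_div, ENNReal.rpow_inv_le_iff hr0]
    calc ∫⁻ x, (∫⁻ y, F x y ∂ν) ^ p.toReal ∂μ
        ≤ ∫⁻ x, ν Set.univ ^ (p.toReal - 1) * ∫⁻ y, F x y ^ p.toReal ∂ν ∂μ :=
          lintegral_mono fun x => lintegral_rpow_le_measure_univ_rpow_mul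
            (hF.of_uncurry_left).aemeasurable hr
      _ = ν Set.univ ^ (p.toReal - 1) * ∫⁻ y, ∫⁻ x, F x y ^ p.toReal ∂μ ∂ν := by
          rw [lintegral_const_mul, lintegral_lintegral_swap]
          · exact (hF.pow_const _).aemeasurable
          · exact Measurable.lintegral_prod_right (hF.pow_const p.toReal)
      _ ≤ ν Set.univ ^ (p.toReal - 1) * ∫⁻ _, K ^ p.toReal ∂ν := by
          refine mul_le_mul_right ?_ _
          refine lintegral_mono_ae (hK.mono fun y hy => ?_)
          rwa [one_div, ENNReal.rpow_inv_le_iff hr0] at hy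
      _ = (ν Set.univ * K) ^ p.toReal := by
          rw [lintegral_const, ENNReal.mul_rpow_of_nonneg _ _ hr0.le, mul_left_comm, mul_comm]
          congr 1
          rcases eq_or_ne (ν Set.univ) 0 with h | h
          · simp [h, hr0]
          · nth_rw 2 [← ENNReal.rpow_one (ν Set.univ)]
            rw [← ENNReal.rpow_add _ _ h (measure_ne_top _ _)]
            congr 1; ring

end Lp

/-! ### Differences in `L^p` and the modulus of continuity. -/

section Differences

variable {n : ℕ} {𝕜 : Type*} [RCLike 𝕜] {p : ℝ≥0∞} {f g : Euc n → 𝕜}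

theorem forwardDiff_ae_congr (h : Euc n) (hfg : f =ᵐ[volume] g) :
    forwardDiff h f =ᵐ[volume] forwardDiff h g := by
  have := (measurePreserving_add_right volume h).quasiMeasurePreserving.ae hfg
  filter_upwards [hfg, this] with x hx hx'
  simp only [forwardDiff, hx, hx']

theorem eLpNorm_forwardDiff_congr (h : Euc n) (hfg : f =ᵐ[volume] g) :
    eLpNorm (forwardDiff h f) p volume = eLpNorm (forwardDiff h g) p volume :=
  eLpNorm_congr_ae (forwardDiff_ae_congr h hfg)

theorem MeasureTheory.AEStronglyMeasurable.comp_add_right_euc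
    (hf : AEStronglyMeasurable f volume) (h : Euc n) :
    AEStronglyMeasurable (fun x => f (x + h)) volume :=
  hf.comp_measurePreserving (measurePreserving_add_right volume h)

theorem aestronglyMeasurable_forwardDiff (hf : AEStronglyMeasurable f volume) (h : Euc n) :
    AEStronglyMeasurable (forwardDiff h f) volume :=
  (hf.comp_add_right_euc h).sub hf

theorem measurable_eLpNorm_forwardDiff (hf : AEStronglyMeasurable f volume) (p : ℝ≥0∞) :
    Measurable fun h => eLpNorm (forwardDiff h f) p volume := by
  have hg := hf.stronglyMeasurable_mk.measurable
  have : (fun h => eLpNorm (forwardDiff h f) p volume) =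
      fun h => eLpNorm (forwardDiff h (hf.mk f)) p volume :=
    funext fun h => eLpNorm_forwardDiff_congr h hf.ae_eq_mk
  rw [this]
  refine measurable_eLpNorm_section (f := fun h => forwardDiff h (hf.mk f)) ?_ p
  exact (hg.comp (measurable_snd.add measurable_fst)).sub (hg.comp measurable_snd)

theorem eLpNorm_comp_add_right (hf : AEStronglyMeasurable f volume) (h : Euc n) :
    eLpNorm (fun x => f (x + h)) p volume = eLpNorm f p volume :=
  eLpNorm_comp_measurePreserving hf (measurePreserving_add_right volume h)

theorem eLpNorm_forwardDiff_add_le (hp : 1 ≤ p) (hf : AEStronglyMeasurable f volume)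
    (h k : Euc n) :
    eLpNorm (forwardDiff (h + k) f) p volume ≤
      eLpNorm (forwardDiff h f) p volume + eLpNorm (forwardDiff k f) p volume := by
  have : forwardDiff (h + k) f = (fun x => forwardDiff h f (x + k)) + forwardDiff k f := by
    ext x
    simp only [forwardDiff, Pi.add_apply, sub_add_sub_cancel]
    congr 2; abel
  rw [this, ← eLpNorm_comp_add_right (aestronglyMeasurable_forwardDiff hf h) k]
  exact eLpNorm_add_le ((aestronglyMeasurable_forwardDiff hf h).comp_add_right_euc k)
    (aestronglyMeasurable_forwardDiff hf k) hp

theorem eLpNorm_forwardDiff_le_two_mul (hp : 1 ≤ p) (hf : AEStronglyMeasurable f volume)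
    (h : Euc n) : eLpNorm (forwardDiff h f) p volume ≤ 2 * eLpNorm f p volume := by
  calc eLpNorm (forwardDiff h f) p volume
      ≤ eLpNorm (fun x => f (x + h)) p volume + eLpNorm f p volume :=
        eLpNorm_sub_le (hf.comp_add_right_euc h) hf hp
    _ = 2 * eLpNorm f p volume := by rw [eLpNorm_comp_add_right hf, two_mul]

theorem monotone_modulusOfContinuity (p : ℝ≥0∞) (f : Euc n → 𝕜) :
    Monotone fun t => modulusOfContinuity p t f := fun _ _ h =>
  biSup_mono fun _ hx => closedBall_subset_closedBall h hx

theorem eLpNorm_forwardDiff_le_modulus {h : Euc n} {t : ℝ} (ht : ‖h‖ ≤ t) :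
    eLpNorm (forwardDiff h f) p volume ≤ modulusOfContinuity p t f :=
  le_iSup₂_of_le h (by simpa using ht) le_rfl

theorem modulusOfContinuity_le_iff {t : ℝ} {K : ℝ≥0∞} :
    modulusOfContinuity p t f ≤ K ↔
      ∀ h : Euc n, ‖h‖ ≤ t → eLpNorm (forwardDiff h f) p volume ≤ K := by
  simp [modulusOfContinuity]

/-- The modulus of continuity is controlled by the averages of the differences. -/
theorem volume_ball_mul_modulusOfContinuity_le (hp : 1 ≤ p)
    (hf : AEStronglyMeasurable f volume) (t : ℝ) :
    volume (ball (0 : Euc n) t) * modulusOfContinuity p t f ≤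
      2 * ∫⁻ y in ball (0 : Euc n) (2 * t), eLpNorm (forwardDiff y f) p volume := by
  have hG := measurable_eLpNorm_forwardDiff hf p
  simp only [modulusOfContinuity, ENNReal.mul_iSup, iSup_le_iff, mem_closedBall_zero_iff]
  intro h hh
  -- For `|h| ≤ t` the reflection `y ↦ h - y` maps the ball of radius `t` into the ball of radius
  -- `2t`.
  have hshift : ∫⁻ y in ball (0 : Euc n) t, eLpNorm (forwardDiff (h - y) f) p volume ≤
      ∫⁻ y in ball (0 : Euc n) (2 * t), eLpNorm (forwardDiff y f) p volume := by
    rw [← lintegral_indicator measurableSet_ball, ← lintegral_indicator measurableSet_ball,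
      ← lintegral_sub_left_eq_self _ h]
    refine lintegral_mono fun y => ?_
    by_cases hy : y ∈ ball (0 : Euc n) (2 * t)
    · rw [Set.indicator_of_mem hy]
      refine (Set.indicator_le_self' (fun _ _ => zero_le) _).trans ?_
      simp
    · rw [Set.indicator_of_notMem, Set.indicator_of_notMem hy]
      rw [mem_ball_zero_iff] at hy ⊢
      have := norm_sub_norm_le y h
      rw [norm_sub_rev] at this
      intro h'; apply hy; linarith
  calc volume (ball (0 : Euc n) t) * eLpNorm (forwardDiff h f) p volume
      = ∫⁻ _ in ball (0 : Euc n) t, eLpNorm (forwardDiff h f) p volume := by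
        rw [setLIntegral_const, mul_comm]
    _ ≤ ∫⁻ y in ball (0 : Euc n) t, (eLpNorm (forwardDiff y f) p volume +
          eLpNorm (forwardDiff (h - y) f) p volume) := by
        refine lintegral_mono fun y => ?_
        simpa using eLpNorm_forwardDiff_add_le hp hf y (h - y)
    _ = (∫⁻ y in ball (0 : Euc n) t, eLpNorm (forwardDiff y f) p volume) +
          ∫⁻ y in ball (0 : Euc n) t, eLpNorm (forwardDiff (h - y) f) p volume :=
        lintegral_add_left hG _
    _ ≤ _ := by
        rw [two_mul]
        refine add_le_add (lintegral_mono_set ?_) hshift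
        rcases le_or_gt 0 t with h0 | h0
        · exact ball_subset_ball (by linarith)
        · simp [ball_eq_empty.2 h0.le]

end Differences

/-! ### Polar coordinates and one-dimensional power weights. -/

section Polar

variable {n : ℕ}

/-- Integration of radial functions in polar coordinates. -/
theorem lintegral_fun_norm_euc (hn : 0 < n) {F : ℝ → ℝ≥0∞} (hF : Measurable F) :
    ∫⁻ x : Euc n, F ‖x‖ = (volume : Measure (Euc n)).toSphere Set.univ *
      ∫⁻ r in Set.Ioi (0 : ℝ), ENNReal.ofReal (r ^ (n - 1)) * F r := by
  have : NeZero n := ⟨hn.ne'⟩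
  have hd : Module.finrank ℝ (Euc n) = n := finrank_euclideanSpace_fin
  calc ∫⁻ x : Euc n, F ‖x‖
      = ∫⁻ x : ({(0)}ᶜ : Set (Euc n)), F ‖x.1‖ ∂(volume.comap Subtype.val) := by
        rw [lintegral_subtype_comap (measurableSet_singleton _).compl fun x : Euc n => F ‖x‖,
          restrict_compl_singleton]
    _ = ∫⁻ x, F x.2 ∂(volume : Measure (Euc n)).toSphere.prod (.volumeIoiPow (n - 1)) := by
        have := (Measure.measurePreserving_homeomorphUnitSphereProd
          (volume : Measure (Euc n))).lintegral_comp_emb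
          (Homeomorph.measurableEmbedding _) (F ∘ Subtype.val ∘ Prod.snd)
        rw [hd] at this
        simpa using this
    _ = _ := by
        rw [lintegral_prod _ (by fun_prop)]
        dsimp only
        rw [lintegral_const, mul_comm]
        congr 1
        rw [Measure.volumeIoiPow, lintegral_withDensity_eq_lintegral_mul _ (by fun_prop)
          (by fun_prop)]
        exact lintegral_subtype_comap measurableSet_Ioi
          fun r : ℝ => ENNReal.ofReal (r ^ (n - 1)) * F r

/-- A radial bound turns an integral over a ball of `ℝⁿ` into a one-dimensional one. -/
theorem lintegral_ball_weight_le (hn : 0 < n) {σ s r : ℝ} (hr : 0 ≤ r) {G : Euc n → ℝ≥0∞}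
    {W : ℝ → ℝ≥0∞} (hW : Measurable W) (hGW : ∀ h, G h ≤ W ‖h‖) :
    ∫⁻ h in ball (0 : Euc n) σ, (ENNReal.ofReal (‖h‖ ^ (-s)) * G h) ^ r *
        ENNReal.ofReal (‖h‖ ^ (-(n : ℝ))) ≤
      (volume : Measure (Euc n)).toSphere Set.univ *
        ∫⁻ t in Set.Ioo 0 σ, (ENNReal.ofReal (t ^ (-s)) * W t) ^ r * ENNReal.ofReal t⁻¹ := by
  set F : ℝ → ℝ≥0∞ := (Set.Iio σ).indicator fun t =>
    (ENNReal.ofReal (t ^ (-s)) * W t) ^ r * ENNReal.ofReal (t ^ (-(n : ℝ))) with hFdef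
  have hF : Measurable F := by
    refine Measurable.indicator ?_ measurableSet_Iio
    fun_prop
  calc _ ≤ ∫⁻ h : Euc n, F ‖h‖ := by
        rw [← lintegral_indicator measurableSet_ball]
        refine lintegral_mono fun h => ?_
        by_cases hh : ‖h‖ < σ
        · rw [Set.indicator_of_mem (by simpa using hh), hFdef,
            Set.indicator_of_mem (Set.mem_Iio.2 hh)]
          gcongr
          exact hGW h
        · rw [Set.indicator_of_notMem (by simpa using hh)]
          exact zero_le
    _ = _ := lintegral_fun_norm_euc hn hF
    _ = _ := by
        congr 1
        rw [← Set.Ioi_inter_Iio, Set.inter_comm, ← setLIntegral_indicator measurableSet_Iio]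
        refine setLIntegral_congr_fun measurableSet_Ioi fun t ht => ?_
        rw [Set.mem_Ioi] at ht
        simp only [hFdef, Set.indicator_apply]
        split_ifs with h
        -- The Jacobian `t^{n-1}` and the weight `t^{-n}` combine to `t^{-1}`.
        · rw [mul_left_comm, ← ENNReal.ofReal_mul (by positivity)]
          congr 2
          rw [← Real.rpow_natCast, ← Real.rpow_add ht, Nat.cast_sub hn, ← Real.rpow_neg_one]
          congr 1
          push_cast; ring
        · simp

theorem lintegral_Ioo_rpow_lt_top {σ a : ℝ} (ha : -1 < a) :
    ∫⁻ t in Set.Ioo 0 σ, ENNReal.ofReal (t ^ a) < ⊤ := by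
  have h : IntegrableOn (fun t : ℝ => t ^ a) (Set.Ioo 0 σ) := by
    rcases le_or_gt σ 0 with h | h
    · simp [Set.Ioo_eq_empty h.not_gt]
    · exact ((intervalIntegrable_iff_integrableOn_Ioo_of_le h.le).1
        (intervalIntegral.intervalIntegrable_rpow' ha))
  exact h.lintegral_lt_top

end Polar

/-! ### Differences of functions with weak derivatives. -/

section WeakDerivative

variable {n : ℕ} {𝕜 : Type*} [RCLike 𝕜] {p : ℝ≥0∞} {f D : Euc n → 𝕜}

/-- All translates of the support of `ψ` by `t • h`, `0 < t ≤ 1`, lie in one closed ball, on which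
`D` is integrable. This justifies the Fubini steps below. -/
theorem integrable_prod_smul_of_hasCompactSupport (hD : LocallyIntegrable D volume) (h : Euc n)
    {ψ : Euc n → ℝ} (hψ : Continuous ψ) (hc : HasCompactSupport ψ) :
    Integrable (fun z : ℝ × Euc n => ψ (z.2 - z.1 • h) • D z.2)
      ((volume.restrict (Set.Ioc (0 : ℝ) 1)).prod volume) := by
  obtain ⟨R, hR⟩ := hc.isCompact.isBounded.subset_closedBall 0
  obtain ⟨C, hC⟩ := hψ.bounded_above_of_compact_support hc
  set K := closedBall (0 : Euc n) (R + ‖h‖)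
  have hK : Integrable (K.indicator D) volume :=
    (integrable_indicator_iff measurableSet_closedBall).2
      (hD.integrableOn_isCompact (isCompact_closedBall _ _))
  have hI := (hK.comp_snd (volume.restrict (Set.Ioc (0 : ℝ) 1))).norm.const_mul C
  have hcont : Continuous fun z : ℝ × Euc n => ψ (z.2 - z.1 • h) := by fun_prop
  refine hI.mono' (hcont.aestronglyMeasurable.smul hD.aestronglyMeasurable.comp_snd) ?_
  have hIoc : ∀ᵐ z : ℝ × Euc n ∂((volume.restrict (Set.Ioc (0 : ℝ) 1)).prod volume),
      z.1 ∈ Set.Ioc (0 : ℝ) 1 :=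
    Measure.quasiMeasurePreserving_fst.ae (ae_restrict_mem measurableSet_Ioc)
  filter_upwards [hIoc] with z hz
  rw [norm_smul]
  by_cases hzK : z.2 ∈ K
  · rw [Set.indicator_of_mem hzK]
    gcongr
    exact hC _
  · have : ψ (z.2 - z.1 • h) = 0 := by
      by_contra hne
      have := hR (subset_tsupport _ hne)
      rw [mem_closedBall_zero_iff] at this
      apply hzK
      rw [mem_closedBall_zero_iff]
      have h1 : ‖z.1 • h‖ ≤ ‖h‖ := by
        rw [norm_smul, Real.norm_of_nonneg hz.1.le]
        exact mul_le_of_le_one_left (norm_nonneg _) hz.2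
      have h2 := norm_sub_norm_le z.2 (z.1 • h)
      linarith
    simp [this, hzK]

theorem integrable_prod_smul_comp_add (hD : LocallyIntegrable D volume) (h : Euc n)
    {ψ : Euc n → ℝ} (hψ : Continuous ψ) (hc : HasCompactSupport ψ) :
    Integrable (fun z : ℝ × Euc n => ψ z.2 • D (z.2 + z.1 • h))
      ((volume.restrict (Set.Ioc (0 : ℝ) 1)).prod volume) := by
  -- The shear moves the translation from `ψ` to `D`.
  have hmp : MeasurePreserving (fun z : ℝ × Euc n => (z.1, z.2 + z.1 • h))
      ((volume.restrict (Set.Ioc (0 : ℝ) 1)).prod volume)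
      ((volume.restrict (Set.Ioc (0 : ℝ) 1)).prod volume) :=
    (MeasurePreserving.id _).skew_product (g := fun t x => x + t • h) (by fun_prop)
      (Filter.Eventually.of_forall fun t => map_add_right_eq_self volume (t • h))
  have := hmp.integrable_comp_of_integrable (integrable_prod_smul_of_hasCompactSupport hD h hψ hc)
  simpa [Function.comp_def] using this

/-- Near a given point the function agrees with its product with a bump, which is integrable by
Fubini. -/
theorem locallyIntegrable_integral_comp_add (hD : LocallyIntegrable D volume) (h : Euc n) :
    LocallyIntegrable (fun x => ∫ t in Set.Ioc (0 : ℝ) 1, D (x + t • h)) volume := by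
  intro x
  let b : ContDiffBump x := ⟨1, 2, one_pos, one_lt_two⟩
  refine ⟨ball x 1, ball_mem_nhds x one_pos, ?_⟩
  have hI := (integrable_prod_smul_comp_add hD h b.continuous b.hasCompactSupport).integral_prod_right
  refine (hI.integrableOn (s := ball x 1)).congr_fun (fun y hy => ?_) measurableSet_ball
  simp [b.one_of_mem_closedBall (ball_subset_closedBall hy)]

/-- A function with a weak directional derivative `D` in the direction `h` is the integral of `D`
along segments. -/
theorem forwardDiff_ae_eq_integral (h : Euc n) (hf : LocallyIntegrable f volume)
    (hD : LocallyIntegrable D volume)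
    (hfD : ∀ φ : Euc n → ℝ, ContDiff ℝ ∞ φ → HasCompactSupport φ →
      ∫ x, (fderiv ℝ φ x h) • f x = - ∫ x, φ x • D x) :
    forwardDiff h f =ᵐ[volume] fun x => ∫ t in Set.Ioc (0 : ℝ) 1, D (x + t • h) := by
  have hfh : LocallyIntegrable (fun x => f (x + h)) volume := by
    intro x
    obtain ⟨s, hs, hsI⟩ := hf (x + h)
    refine ⟨(fun x => x + h) ⁻¹' s, (continuous_add_const h).continuousAt hs, ?_⟩
    exact ((measurePreserving_add_right volume h).integrableOn_comp_preimage
      (Homeomorph.addRight h).measurableEmbedding).2 hsI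
  refine ae_eq_of_integral_contDiff_smul_eq (hfh.sub hf)
    (locallyIntegrable_integral_comp_add hD h) fun φ hφ hφc => ?_
  have htr (t : ℝ) : HasCompactSupport fun x => φ (x - t • h) := by
    simpa [Function.comp_def, sub_eq_add_neg] using
      hφc.comp_homeomorph (Homeomorph.addRight (-(t • h)))
  have hφ' : Continuous fun x => fderiv ℝ φ x h := by
    have := hφ.continuous_fderiv (by simp)
    fun_prop
  have hφ'c : HasCompactSupport fun x => fderiv ℝ φ x h :=
    hφc.fderiv_apply (𝕜 := ℝ) h
  have hI1 : Integrable (fun x => φ (x - h) • f x) volume := by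
    refine hf.integrable_smul_left_of_hasCompactSupport (by fun_prop) ?_
    simpa using htr 1
  have hI2 : Integrable (fun x => φ x • f x) volume :=
    hf.integrable_smul_left_of_hasCompactSupport hφ.continuous hφc
  have hI3 : Integrable (fun x => φ x • f (x + h)) volume :=
    hfh.integrable_smul_left_of_hasCompactSupport hφ.continuous hφc
  -- The fundamental theorem of calculus is applied to the test function; the weak derivative
  -- identity is then used for each translate `φ(· - t • h)`.
  have hder (x : Euc n) :
      φ (x - h) - φ x = - ∫ t in Set.Ioc (0 : ℝ) 1, fderiv ℝ φ (x - t • h) h := by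
    have hd : ∀ t ∈ Set.uIcc (0 : ℝ) 1,
        HasDerivAt (fun t : ℝ => φ (x - t • h)) (-(fderiv ℝ φ (x - t • h) h)) t := by
      intro t _
      have h1 : HasDerivAt (fun t : ℝ => x - t • h) (-h) t := by
        simpa using ((hasDerivAt_id t).smul_const h).const_sub x
      have h2 := ((hφ.differentiable (by simp)) (x - t • h)).hasFDerivAt.comp_hasDerivAt t h1
      simpa only [map_neg, Function.comp_def] using h2
    have hc : Continuous fun t : ℝ => -(fderiv ℝ φ (x - t • h) h) :=
      (hφ'.comp (by fun_prop : Continuous fun t : ℝ => x - t • h)).neg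
    have := intervalIntegral.integral_eq_sub_of_hasDerivAt hd (hc.intervalIntegrable _ _)
    rw [intervalIntegral.integral_neg, intervalIntegral.integral_of_le zero_le_one] at this
    simpa using this.symm
  calc ∫ x, φ x • (f (x + h) - f x)
      = ∫ x, (φ (x - h) - φ x) • f x := by
        simp only [smul_sub, sub_smul]
        rw [integral_sub hI3 hI2, integral_sub hI1 hI2]
        congr 1
        rw [← integral_add_right_eq_self (fun x => φ (x - h) • f x) h]
        simp
    _ = - ∫ x, ∫ t in Set.Ioc (0 : ℝ) 1, (fderiv ℝ φ (x - t • h) h) • f x := by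
        rw [← integral_neg]
        refine integral_congr_ae (Filter.Eventually.of_forall fun x => ?_)
        simp only [hder, neg_smul]
        rw [integral_smul_const]
    _ = - ∫ t in Set.Ioc (0 : ℝ) 1, ∫ x, (fderiv ℝ φ (x - t • h) h) • f x := by
        rw [integral_integral_swap]
        exact (integrable_prod_smul_of_hasCompactSupport hf h hφ' hφ'c).swap
    _ = ∫ t in Set.Ioc (0 : ℝ) 1, ∫ x, φ x • D (x + t • h) := by
        rw [← integral_neg]
        refine integral_congr_ae (Filter.Eventually.of_forall fun t => ?_)
        have h1 := hfD (fun x => φ (x - t • h)) (hφ.comp (by fun_prop)) (htr t)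
        simp only [fderiv_comp_sub] at h1
        simp only [h1, neg_neg]
        rw [← integral_add_right_eq_self (fun x => φ (x - t • h) • D x) (t • h)]
        simp
    _ = ∫ x, φ x • ∫ t in Set.Ioc (0 : ℝ) 1, D (x + t • h) := by
        rw [integral_integral_swap]
        · simp only [integral_smul]
        · exact integrable_prod_smul_comp_add hD h hφ.continuous hφc

/-- Minkowski's inequality for the average along a unit parameter interval: every translate of `D`
has the same norm. A strongly measurable representative of `D` provides the joint measurability. -/
theorem eLpNorm_forwardDiff_le_of_weakDeriv (hp : 1 ≤ p) (h : Euc n)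
    (hf : LocallyIntegrable f volume) (hD : LocallyIntegrable D volume)
    (hfD : ∀ φ : Euc n → ℝ, ContDiff ℝ ∞ φ → HasCompactSupport φ →
      ∫ x, (fderiv ℝ φ x h) • f x = - ∫ x, φ x • D x) :
    eLpNorm (forwardDiff h f) p volume ≤ eLpNorm D p volume := by
  have hDm := hD.aestronglyMeasurable
  have hmk := hDm.ae_eq_mk
  have hD' : LocallyIntegrable (hDm.mk D) volume := hD.congr hmk
  have hfD' : ∀ φ : Euc n → ℝ, ContDiff ℝ ∞ φ → HasCompactSupport φ →
      ∫ x, (fderiv ℝ φ x h) • f x = - ∫ x, φ x • hDm.mk D x := fun φ hφ hφc => by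
    rw [hfD φ hφ hφc]
    congr 1
    refine integral_congr_ae (hmk.mono fun x hx => ?_)
    simp only [hx]
  rw [eLpNorm_congr_ae (forwardDiff_ae_eq_integral h hf hD' hfD'), eLpNorm_congr_ae hmk]
  have hm := hDm.stronglyMeasurable_mk.measurable
  calc eLpNorm (fun x => ∫ t in Set.Ioc (0 : ℝ) 1, hDm.mk D (x + t • h)) p volume
      ≤ eLpNorm (fun x => ∫⁻ t in Set.Ioc (0 : ℝ) 1, ‖hDm.mk D (x + t • h)‖ₑ) p volume :=
        eLpNorm_mono_enorm fun x => by
          simpa using enorm_integral_le_lintegral_enorm _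
    _ ≤ volume.restrict (Set.Ioc (0 : ℝ) 1) Set.univ * eLpNorm (hDm.mk D) p volume := by
        refine eLpNorm_lintegral_le hp ?_ (Filter.Eventually.of_forall fun t => ?_)
        · exact (hm.comp (by fun_prop :
            Measurable fun z : Euc n × ℝ => z.1 + z.2 • h)).enorm
        · rw [← eLpNorm_comp_add_right hDm.stronglyMeasurable_mk.aestronglyMeasurable (t • h)]
          exact (eLpNorm_enorm _).le
    _ = eLpNorm (hDm.mk D) p volume := by simp

/-- The weak derivative in direction `h` is `∑ h_j ∂_j f`, and `|h_j| ≤ ‖h‖`. -/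
theorem eLpNorm_forwardDiff_le_of_isWeakPartial (hp : 1 ≤ p) (h : Euc n)
    (hf : LocallyIntegrable f volume) {g : Fin n → Euc n → 𝕜} (hg : ∀ j, IsWeakPartial j f (g j)) :
    eLpNorm (forwardDiff h f) p volume ≤
      ENNReal.ofReal ‖h‖ * ∑ j, eLpNorm (g j) p volume := by
  have hgl : ∀ j, LocallyIntegrable (g j) volume := fun j => (hg j).2.1
  have hD : LocallyIntegrable (fun x => ∑ j, h j • g j x) volume :=
    locallyIntegrable_finsetSum _ fun j _ => (hgl j).smul (h j)
  refine (eLpNorm_forwardDiff_le_of_weakDeriv hp h hf hD fun φ hφ hφc => ?_).trans ?_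
  · have hsum (x : Euc n) : fderiv ℝ φ x h =
        ∑ j, h j * fderiv ℝ φ x (EuclideanSpace.single j 1) := by
      conv_lhs => rw [← (EuclideanSpace.basisFun (Fin n) ℝ).sum_repr h]
      simp
    simp only [hsum, Finset.sum_smul, Finset.smul_sum]
    rw [integral_finsetSum, integral_finsetSum, ← Finset.sum_neg_distrib]
    · refine Finset.sum_congr rfl fun j _ => ?_
      simp only [mul_smul, smul_comm (φ _) (h j)]
      rw [integral_smul, integral_smul, (hg j).2.2 φ hφ hφc, smul_neg]
    · intro j _
      exact ((hgl j).smul (h j)).integrable_smul_left_of_hasCompactSupport hφ.continuous hφc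
    · intro j _
      simp only [mul_smul]
      refine (hf.integrable_smul_left_of_hasCompactSupport ?_ ?_).smul (h j)
      · have := hφ.continuous_fderiv (by simp)
        fun_prop
      · exact hφc.fderiv_apply (𝕜 := ℝ) _
  · have hsum : (fun x => ∑ j, h j • g j x) = ∑ j, h j • g j := by
      ext x; simp
    rw [hsum, Finset.mul_sum]
    refine (eLpNorm_sum_le (fun j _ => ((hgl j).smul (h j)).aestronglyMeasurable) hp).trans ?_
    refine Finset.sum_le_sum fun j _ => ?_
    rw [eLpNorm_const_smul, ← ofReal_norm]
    gcongr
    exact PiLp.norm_apply_le h j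

end WeakDerivative

/-! ### From the sum to the screened norm; power means bounding the modulus. -/

section BesovEstimates

variable {n : ℕ} {𝕜 : Type*} [RCLike 𝕜] {p q : ℝ≥0∞}

theorem forwardDiff_zero (f : Euc n → 𝕜) : forwardDiff 0 f = 0 := by
  ext x; simp [forwardDiff]

theorem ofReal_rpow_rpow {t : ℝ} (ht : 0 ≤ t) (a : ℝ) {r : ℝ} (hr : 0 ≤ r) :
    ENNReal.ofReal (t ^ a) ^ r = ENNReal.ofReal (t ^ (a * r)) := by
  rw [ENNReal.ofReal_rpow_of_nonneg (by positivity) hr, Real.rpow_mul ht]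

theorem one_le_toReal_of_one_le (hq : 1 ≤ q) (hq' : q ≠ ⊤) : 1 ≤ q.toReal := by
  simpa using ENNReal.toReal_mono hq' hq

/-- The screened seminorm is controlled by a homogeneous Besov seminorm and a Lipschitz bound. -/
theorem exists_screenedBesovSeminorm_le (hn : 0 < n) {σ s : ℝ} (hs : s ∈ Set.Ioo (0 : ℝ) 1)
    (p : ℝ≥0∞) (hq : 1 ≤ q) :
    ∃ C : ℝ≥0, ∀ (f f₀ : Euc n → 𝕜) (S : ℝ≥0∞),
      (∀ h, eLpNorm (forwardDiff h f) p volume ≤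
        modulusOfContinuity p ‖h‖ f₀ + ENNReal.ofReal ‖h‖ * S) →
      screenedBesovSeminorm σ s p q f ≤ C * (homogeneousBesovSeminorm s p q f₀ + S) := by
  obtain ⟨hs0, hs1⟩ := hs
  by_cases hqt : q = ⊤
  · refine ⟨1 + Real.toNNReal (σ ^ (1 - s)), fun f f₀ S hf => ?_⟩
    simp only [screenedBesovSeminorm, homogeneousBesovSeminorm, hqt, if_true]
    set B := ⨆ t ∈ Set.Ioi (0 : ℝ), ENNReal.ofReal (t ^ (-s)) * modulusOfContinuity p t f₀
    refine essSup_le_of_ae_le _ ?_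
    filter_upwards [ae_restrict_mem measurableSet_ball] with h hh
    rw [mem_ball_zero_iff] at hh
    -- At `h = 0` the weight is `0`, by the convention `0 ^ (-s) = 0` for `s ≠ 0`.
    rcases (norm_nonneg h).eq_or_lt with h0 | h0
    · rw [← h0, Real.zero_rpow (by linarith)]
      simp
    · have h1 : ENNReal.ofReal (‖h‖ ^ (-s)) * modulusOfContinuity p ‖h‖ f₀ ≤ B :=
        le_iSup₂_of_le ‖h‖ h0 le_rfl
      have h2 : ENNReal.ofReal (‖h‖ ^ (-s)) * ENNReal.ofReal ‖h‖ ≤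
          ENNReal.ofReal (σ ^ (1 - s)) := by
        rw [← ENNReal.ofReal_mul (by positivity)]
        refine ENNReal.ofReal_le_ofReal ?_
        rw [← Real.rpow_add_one h0.ne', neg_add_eq_sub]
        exact Real.rpow_le_rpow h0.le hh.le (by linarith)
      calc ENNReal.ofReal (‖h‖ ^ (-s)) * eLpNorm (forwardDiff h f) p volume
          ≤ ENNReal.ofReal (‖h‖ ^ (-s)) *
              (modulusOfContinuity p ‖h‖ f₀ + ENNReal.ofReal ‖h‖ * S) := by
            gcongr; exact hf h
        _ ≤ B + ENNReal.ofReal (σ ^ (1 - s)) * S := by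
            rw [mul_add, ← mul_assoc]; gcongr
        _ ≤ (1 + ENNReal.ofReal (σ ^ (1 - s))) * (B + S) := by
            rw [add_mul, one_mul]
            gcongr
            · exact le_self_add
            · exact le_add_self
        _ = _ := by simp [ENNReal.ofReal]
  · have hr := one_le_toReal_of_one_le hq hqt
    set r := q.toReal
    have hr0 : 0 < r := by linarith
    set A := ∫⁻ t in Set.Ioo 0 σ, ENNReal.ofReal (t ^ ((1 - s) * r - 1))
    -- The exponent exceeds `-1` because `s < 1`.
    have hA : A < ⊤ := lintegral_Ioo_rpow_lt_top (by nlinarith)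
    set c := (volume : Measure (Euc n)).toSphere Set.univ
    have hc : c ≠ ⊤ := measure_ne_top _ _
    -- `c` is the area of the sphere, and `2 ^ (r - 1)` comes from `(x + y)^r ≤ 2^{r-1} (x^r +
    -- y^r)`.
    set K : ℝ≥0∞ := (c * (2 ^ (r - 1) * (1 + A))) ^ (1 / r)
    have hK : K ≠ ⊤ := by
      refine ENNReal.rpow_ne_top_of_nonneg (by positivity) ?_
      have : (2 : ℝ≥0∞) ^ (r - 1) ≠ ⊤ :=
        ENNReal.rpow_ne_top_of_nonneg (by linarith) ENNReal.ofNat_ne_top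
      finiteness
    refine ⟨K.toNNReal, fun f f₀ S hf => ?_⟩
    rw [ENNReal.coe_toNNReal hK]
    simp only [screenedBesovSeminorm, homogeneousBesovSeminorm, hqt, if_false]
    set B := ∫⁻ t in Set.Ioi (0 : ℝ),
      (ENNReal.ofReal (t ^ (-s)) * modulusOfContinuity p t f₀) ^ r * ENNReal.ofReal t⁻¹
    have hω : Measurable fun t => modulusOfContinuity p t f₀ :=
      (monotone_modulusOfContinuity p f₀).measurable
    have hle : ∫⁻ h in ball (0 : Euc n) σ, (ENNReal.ofReal (‖h‖ ^ (-s)) *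
        eLpNorm (forwardDiff h f) p volume) ^ r * ENNReal.ofReal (‖h‖ ^ (-(n : ℝ))) ≤
        c * (2 ^ (r - 1) * (1 + A)) * (B ^ (1 / r) + S) ^ r := by
      refine (lintegral_ball_weight_le hn hr0.le
        (W := fun t => modulusOfContinuity p t f₀ + ENNReal.ofReal t * S) (by fun_prop)
        hf).trans ?_
      rw [mul_assoc]
      gcongr
      have hB : B ≤ (B ^ (1 / r) + S) ^ r := by
        calc B = (B ^ (1 / r)) ^ r := by
              rw [← ENNReal.rpow_mul, one_div_mul_cancel hr0.ne', ENNReal.rpow_one]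
          _ ≤ _ := by gcongr; exact le_self_add
      have hS : S ^ r ≤ (B ^ (1 / r) + S) ^ r := by
        gcongr; exact le_add_self
      calc ∫⁻ t in Set.Ioo 0 σ, (ENNReal.ofReal (t ^ (-s)) *
              (modulusOfContinuity p t f₀ + ENNReal.ofReal t * S)) ^ r * ENNReal.ofReal t⁻¹
          ≤ ∫⁻ t in Set.Ioo 0 σ, (2 ^ (r - 1) * ((ENNReal.ofReal (t ^ (-s)) *
              modulusOfContinuity p t f₀) ^ r * ENNReal.ofReal t⁻¹) +
              2 ^ (r - 1) * (S ^ r * ENNReal.ofReal (t ^ ((1 - s) * r - 1)))) := by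
            refine setLIntegral_mono' measurableSet_Ioo fun t ht => ?_
            have ht0 : 0 < t := ht.1
            have e : (ENNReal.ofReal (t ^ (-s)) * (ENNReal.ofReal t * S)) ^ r *
                ENNReal.ofReal t⁻¹ = S ^ r * ENNReal.ofReal (t ^ ((1 - s) * r - 1)) := by
              rw [← mul_assoc, ← ENNReal.ofReal_mul (by positivity), ← Real.rpow_add_one ht0.ne',
                ENNReal.mul_rpow_of_nonneg _ _ hr0.le, ofReal_rpow_rpow ht0.le _ hr0.le,
                mul_comm _ (S ^ r), mul_assoc, ← ENNReal.ofReal_mul (by positivity),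
                ← Real.rpow_neg_one t, ← Real.rpow_add ht0, neg_add_eq_sub, ← sub_eq_add_neg]
            rw [← e, mul_add]
            calc _ ≤ (2 ^ (r - 1) * ((ENNReal.ofReal (t ^ (-s)) * modulusOfContinuity p t f₀) ^ r +
                    (ENNReal.ofReal (t ^ (-s)) * (ENNReal.ofReal t * S)) ^ r)) *
                    ENNReal.ofReal t⁻¹ := by
                  gcongr
                  exact ENNReal.rpow_add_le_mul_rpow_add_rpow _ _ hr
              _ = _ := by ring
        _ = 2 ^ (r - 1) * (∫⁻ t in Set.Ioo 0 σ, (ENNReal.ofReal (t ^ (-s)) *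
              modulusOfContinuity p t f₀) ^ r * ENNReal.ofReal t⁻¹) +
              2 ^ (r - 1) * (S ^ r * A) := by
            rw [lintegral_add_right _ (by fun_prop), lintegral_const_mul _ (by fun_prop),
              lintegral_const_mul _ (by fun_prop), lintegral_const_mul _ (by fun_prop)]
        _ ≤ 2 ^ (r - 1) * (B ^ (1 / r) + S) ^ r +
              2 ^ (r - 1) * ((B ^ (1 / r) + S) ^ r * A) := by
            gcongr
            exact (lintegral_mono_set Set.Ioo_subset_Ioi_self).trans hB
        _ = _ := by ring
    calc _ ≤ (c * (2 ^ (r - 1) * (1 + A)) * (B ^ (1 / r) + S) ^ r) ^ (1 / r) := by gcongr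
      _ = _ := by
        rw [ENNReal.mul_rpow_of_nonneg _ _ (by positivity), ← ENNReal.rpow_mul,
          mul_one_div_cancel hr0.ne', ENNReal.rpow_one]

theorem volume_ball_euc {t : ℝ} (ht : 0 ≤ t) (hn : 0 < n) :
    volume (ball (0 : Euc n) t) =
      ENNReal.ofReal (t ^ (n : ℝ)) * volume (ball (0 : Euc n) 1) := by
  have : NeZero n := ⟨hn.ne'⟩
  rw [Measure.addHaar_ball _ _ ht, finrank_euclideanSpace_fin, Real.rpow_natCast]

theorem volume_ball_two_mul {t : ℝ} (ht : 0 ≤ t) (hn : 0 < n) :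
    volume (ball (0 : Euc n) (2 * t)) =
      2 ^ (n : ℝ) * volume (ball (0 : Euc n) t) := by
  rw [volume_ball_euc (by positivity) hn, volume_ball_euc ht hn, Real.mul_rpow (by simp) ht,
    ENNReal.ofReal_mul (by positivity), ← ENNReal.ofReal_rpow_of_nonneg (by simp) (by simp),
    ENNReal.ofReal_ofNat, mul_assoc]

/-- Jensen's inequality turns the mean of the differences over the ball of radius `2t` into a mean
of their `r`-th powers; `t^{-n}` normalises the ball. -/
theorem exists_modulusOfContinuity_rpow_le (hn : 0 < n) (hp : 1 ≤ p) {r : ℝ} (hr : 1 ≤ r) :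
    ∃ K : ℝ≥0, ∀ f : Euc n → 𝕜, AEStronglyMeasurable f volume → ∀ t : ℝ, 0 < t →
      modulusOfContinuity p t f ^ r ≤ K * (ENNReal.ofReal (t ^ (-(n : ℝ))) *
        ∫⁻ y in ball (0 : Euc n) (2 * t), eLpNorm (forwardDiff y f) p volume ^ r) := by
  have hr0 : 0 < r := by linarith
  set b := volume (ball (0 : Euc n) 1)
  have hb0 : b ≠ 0 := (measure_ball_pos volume _ one_pos).ne'
  have hb : b ≠ ⊤ := measure_ball_lt_top.ne
  -- The factors come from the averaging bound, from Jensen on a ball of doubled radius, and from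
  -- the volume normalisation.
  set K : ℝ≥0∞ := 2 ^ r * (2 ^ (n : ℝ)) ^ (r - 1) * b⁻¹
  have hK : K ≠ ⊤ := by
    have h1 : (2 : ℝ≥0∞) ^ r ≠ ⊤ := ENNReal.rpow_ne_top_of_nonneg hr0.le ENNReal.ofNat_ne_top
    have h2 : ((2 : ℝ≥0∞) ^ (n : ℝ)) ^ (r - 1) ≠ ⊤ :=
      ENNReal.rpow_ne_top_of_nonneg (by linarith)
        (ENNReal.rpow_ne_top_of_nonneg (by positivity) ENNReal.ofNat_ne_top)
    exact ENNReal.mul_ne_top (ENNReal.mul_ne_top h1 h2) (ENNReal.inv_ne_top.2 hb0)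
  refine ⟨K.toNNReal, fun f hf t ht => ?_⟩
  rw [ENNReal.coe_toNNReal hK]
  set V := volume (ball (0 : Euc n) t) with hV
  have hV0 : V ≠ 0 := (measure_ball_pos volume _ ht).ne'
  have hVt : V ≠ ⊤ := measure_ball_lt_top.ne
  set I := ∫⁻ y in ball (0 : Euc n) (2 * t), eLpNorm (forwardDiff y f) p volume ^ r
  have hVinv : V⁻¹ = ENNReal.ofReal (t ^ (-(n : ℝ))) * b⁻¹ := by
    rw [hV, volume_ball_euc ht.le hn, ENNReal.mul_inv (Or.inr hb) (Or.inr hb0),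
      ← ENNReal.ofReal_inv_of_pos (by positivity), Real.rpow_neg ht.le]
  have h1 : (V * modulusOfContinuity p t f) ^ r ≤
      2 ^ r * ((2 ^ (n : ℝ) * V) ^ (r - 1) * I) := by
    refine (ENNReal.rpow_le_rpow (volume_ball_mul_modulusOfContinuity_le hp hf t) hr0.le).trans ?_
    rw [ENNReal.mul_rpow_of_nonneg _ _ hr0.le, ← volume_ball_two_mul ht.le hn]
    gcongr
    have hfin : IsFiniteMeasure (volume.restrict (ball (0 : Euc n) (2 * t))) :=
      ⟨by simpa using measure_ball_lt_top⟩
    have := lintegral_rpow_le_measure_univ_rpow_mul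
      (ν := volume.restrict (ball (0 : Euc n) (2 * t)))
      (measurable_eLpNorm_forwardDiff hf p).aemeasurable hr
    simpa using this
  have hVr0 : V ^ r ≠ 0 := by simp [hV0, hVt]
  have hVrt : V ^ r ≠ ⊤ := ENNReal.rpow_ne_top_of_nonneg hr0.le hVt
  calc modulusOfContinuity p t f ^ r
      = (V ^ r)⁻¹ * (V * modulusOfContinuity p t f) ^ r := by
        rw [ENNReal.mul_rpow_of_nonneg _ _ hr0.le, ← mul_assoc,
          ENNReal.inv_mul_cancel hVr0 hVrt, one_mul]
    _ ≤ (V ^ r)⁻¹ * (2 ^ r * ((2 ^ (n : ℝ) * V) ^ (r - 1) * I)) := by gcongr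
    _ = 2 ^ r * (2 ^ (n : ℝ)) ^ (r - 1) * ((V ^ r)⁻¹ * V ^ (r - 1)) * I := by
        rw [ENNReal.mul_rpow_of_nonneg _ _ (by linarith)]; ring
    _ = 2 ^ r * (2 ^ (n : ℝ)) ^ (r - 1) * V⁻¹ * I := by
        rw [← ENNReal.rpow_neg, ← ENNReal.rpow_add _ _ hV0 hVt, show -r + (r - 1) = -1 by ring,
          ENNReal.rpow_neg_one]
    _ = K * (ENNReal.ofReal (t ^ (-(n : ℝ))) * I) := by rw [hVinv]; ring

end BesovEstimates

/-! ### The screened norm bounds the modulus at scales up to `T`. -/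

section ScreenedToHomogeneous

variable {n : ℕ} {𝕜 : Type*} [RCLike 𝕜] {p q : ℝ≥0∞}

theorem rpow_mul_weight {G : ℝ≥0∞} {x s r : ℝ} (a : ℝ) (hx : 0 < x) (hr : 0 ≤ r) :
    (ENNReal.ofReal (x ^ (-s)) * G) ^ r * ENNReal.ofReal (x ^ a) =
      G ^ r * ENNReal.ofReal (x ^ (a - s * r)) := by
  rw [ENNReal.mul_rpow_of_nonneg _ _ hr, ofReal_rpow_rpow hx.le _ hr, mul_comm _ (G ^ r), mul_assoc,
    ← ENNReal.ofReal_mul (by positivity), ← Real.rpow_add hx]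
  congr 3; ring

theorem eLpNorm_forwardDiff_zero_rpow (f : Euc n → 𝕜) {r : ℝ} (hr : 0 < r) :
    eLpNorm (forwardDiff 0 f) p volume ^ r = 0 := by
  simp [forwardDiff_zero, hr]

/-- For `h ≠ 0` the exponents add; at `h = 0` both sides vanish since `Δ_0 f = 0`, whatever values
the powers of zero take. -/
theorem rpow_mul_weight_norm (f : Euc n → 𝕜) (h : Euc n) (s : ℝ) {r : ℝ} (hr : 0 < r) :
    (ENNReal.ofReal (‖h‖ ^ (-s)) * eLpNorm (forwardDiff h f) p volume) ^ r *
        ENNReal.ofReal (‖h‖ ^ (-(n : ℝ))) =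
      eLpNorm (forwardDiff h f) p volume ^ r * ENNReal.ofReal (‖h‖ ^ (-(n : ℝ) - s * r)) := by
  rcases eq_or_ne h 0 with rfl | h0
  · simp [forwardDiff_zero, hr]
  · exact rpow_mul_weight _ (norm_pos_iff.2 h0) hr.le

theorem lintegral_Ioi_rpow {a c : ℝ} (ha : a < -1) (hc : 0 < c) :
    ∫⁻ t in Set.Ioi c, ENNReal.ofReal (t ^ a) = ENNReal.ofReal (-c ^ (a + 1) / (a + 1)) := by
  rw [← integral_Ioi_rpow_of_lt ha hc, ofReal_integral_eq_lintegral_ofReal]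
  · exact integrableOn_Ioi_rpow_of_lt ha hc
  · filter_upwards [ae_restrict_mem measurableSet_Ioi] with t ht
    exact Real.rpow_nonneg (hc.trans ht).le _

/-- The part of the homogeneous Besov seminorm near `0` is controlled by the screened one. -/
theorem exists_lintegral_Ioc_modulus_le (hn : 0 < n) (hp : 1 ≤ p) {s r : ℝ} (hs : 0 < s)
    (hr : 1 ≤ r) :
    ∃ K : ℝ≥0, ∀ f : Euc n → 𝕜, AEStronglyMeasurable f volume → ∀ T : ℝ,
      ∫⁻ t in Set.Ioc 0 T, (ENNReal.ofReal (t ^ (-s)) * modulusOfContinuity p t f) ^ r *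
        ENNReal.ofReal t⁻¹ ≤
      K * ∫⁻ h in ball (0 : Euc n) (2 * T), (ENNReal.ofReal (‖h‖ ^ (-s)) *
        eLpNorm (forwardDiff h f) p volume) ^ r * ENNReal.ofReal (‖h‖ ^ (-(n : ℝ))) := by
  have hr0 : 0 < r := by linarith
  obtain ⟨K, hK⟩ := exists_modulusOfContinuity_rpow_le (n := n) (𝕜 := 𝕜) hn hp hr
  set a : ℝ := -(n : ℝ) - s * r - 1 with ha
  have han : a < -1 := by
    have : (0 : ℝ) < n := by exact_mod_cast hn
    have : 0 < s * r := by positivity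
    linarith
  -- After Tonelli on the region `‖y‖ < 2t`, the inner integral of `t ^ a` runs over `t > ‖y‖ / 2`.
  -- By scaling it is `L` times `‖y‖^{-n-sr}`.
  set L : ℝ≥0 := Real.toNNReal (-(1 / 2) ^ (a + 1) / (a + 1)) with hL
  refine ⟨K * L, fun f hf T => ?_⟩
  simp only [rpow_mul_weight_norm f _ s hr0]
  set G : Euc n → ℝ≥0∞ := fun y => eLpNorm (forwardDiff y f) p volume ^ r with hG
  have hGm : Measurable G := (measurable_eLpNorm_forwardDiff hf p).pow_const r
  have hS : MeasurableSet {z : ℝ × Euc n | ‖z.2‖ < 2 * z.1} :=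
    measurableSet_lt (by fun_prop) (by fun_prop)
  have hmeas : Measurable (Function.uncurry fun (t : ℝ) (y : Euc n) =>
      ({z : ℝ × Euc n | ‖z.2‖ < 2 * z.1}.indicator
        (fun z => ENNReal.ofReal (z.1 ^ a) * G z.2)) (t, y)) := by
    refine Measurable.indicator ?_ hS
    have : Measurable fun z : ℝ × Euc n => G z.2 := hGm.comp measurable_snd
    fun_prop
  have hinner (t : ℝ) :
      ENNReal.ofReal (t ^ a) * ∫⁻ y in ball (0 : Euc n) (2 * t), G y =
        ∫⁻ y, ({z : ℝ × Euc n | ‖z.2‖ < 2 * z.1}.indicator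
          (fun z => ENNReal.ofReal (z.1 ^ a) * G z.2)) (t, y) := by
    rw [← lintegral_const_mul _ hGm, ← lintegral_indicator measurableSet_ball]
    refine lintegral_congr fun y => ?_
    by_cases hy : ‖y‖ < 2 * t
    · rw [Set.indicator_of_mem (by simpa using hy), Set.indicator_of_mem (by simpa using hy)]
    · rw [Set.indicator_of_notMem (by simpa using hy), Set.indicator_of_notMem (by simpa using hy)]
  calc ∫⁻ t in Set.Ioc 0 T, (ENNReal.ofReal (t ^ (-s)) * modulusOfContinuity p t f) ^ r *
        ENNReal.ofReal t⁻¹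
      ≤ ∫⁻ t in Set.Ioc 0 T, K * (ENNReal.ofReal (t ^ a) *
          ∫⁻ y in ball (0 : Euc n) (2 * t), G y) := by
        refine setLIntegral_mono' measurableSet_Ioc fun t ht => ?_
        have ht0 : 0 < t := ht.1
        rw [← Real.rpow_neg_one, rpow_mul_weight _ ht0 hr0.le]
        calc _ ≤ K * (ENNReal.ofReal (t ^ (-(n : ℝ))) *
                ∫⁻ y in ball (0 : Euc n) (2 * t), G y) * ENNReal.ofReal (t ^ (-1 - s * r)) := by
              gcongr
              exact hK f hf t ht0
          _ = K * (ENNReal.ofReal (t ^ (-(n : ℝ))) * ENNReal.ofReal (t ^ (-1 - s * r)) *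
                ∫⁻ y in ball (0 : Euc n) (2 * t), G y) := by ring
          _ = _ := by
              rw [← ENNReal.ofReal_mul (by positivity), ← Real.rpow_add ht0]
              rw [ha, show -(n : ℝ) + (-1 - s * r) = -(n : ℝ) - s * r - 1 by ring]
    _ = K * ∫⁻ t in Set.Ioc 0 T, ∫⁻ y, ({z : ℝ × Euc n | ‖z.2‖ < 2 * z.1}.indicator
          (fun z => ENNReal.ofReal (z.1 ^ a) * G z.2)) (t, y) := by
        rw [lintegral_const_mul' _ _ ENNReal.coe_ne_top]
        simp only [hinner]
    _ = K * ∫⁻ y, ∫⁻ t in Set.Ioc 0 T, ({z : ℝ × Euc n | ‖z.2‖ < 2 * z.1}.indicator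
          (fun z => ENNReal.ofReal (z.1 ^ a) * G z.2)) (t, y) := by
        rw [lintegral_lintegral_swap hmeas.aemeasurable]
    _ ≤ K * ∫⁻ y, (ball (0 : Euc n) (2 * T)).indicator
          (fun y => L * (G y * ENNReal.ofReal (‖y‖ ^ (-(n : ℝ) - s * r)))) y := by
        gcongr with y
        by_cases hy : ‖y‖ < 2 * T
        · rw [Set.indicator_of_mem (by simpa using hy)]
          rcases eq_or_ne y 0 with rfl | hy0
          · simp [hG, eLpNorm_forwardDiff_zero_rpow f hr0, Set.indicator_apply]
          have hy1 : 0 < ‖y‖ := norm_pos_iff.2 hy0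
          calc ∫⁻ t in Set.Ioc 0 T, ({z : ℝ × Euc n | ‖z.2‖ < 2 * z.1}.indicator
                (fun z => ENNReal.ofReal (z.1 ^ a) * G z.2)) (t, y)
              ≤ ∫⁻ t, (Set.Ioi (‖y‖ / 2)).indicator (fun t => ENNReal.ofReal (t ^ a) * G y) t := by
                refine (setLIntegral_le_lintegral _ _).trans (lintegral_mono fun t => ?_)
                by_cases ht : ‖y‖ / 2 < t
                · rw [Set.indicator_of_mem (Set.mem_Ioi.2 ht),
                    Set.indicator_of_mem (by rw [Set.mem_ofPred_eq]; linarith)]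
                · rw [Set.indicator_of_notMem (by rw [Set.mem_ofPred_eq]; intro h; apply ht; linarith)]
                  exact zero_le
            _ = ENNReal.ofReal (-(‖y‖ / 2) ^ (a + 1) / (a + 1)) * G y := by
                rw [lintegral_indicator measurableSet_Ioi, lintegral_mul_const _ (by fun_prop),
                  lintegral_Ioi_rpow han (by positivity)]
            _ = _ := by
                have : -(‖y‖ / 2) ^ (a + 1) / (a + 1) =
                    (-(1 / 2) ^ (a + 1) / (a + 1)) * ‖y‖ ^ (-(n : ℝ) - s * r) := by
                  rw [div_eq_mul_one_div ‖y‖ 2, Real.mul_rpow hy1.le (by norm_num), ha,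
                    sub_add_cancel]
                  ring
                rw [this, ENNReal.ofReal_mul]
                · rw [mul_comm (G y), ← mul_assoc]; rfl
                · exact div_nonneg_of_nonpos (neg_nonpos.2 (by positivity)) (by linarith)
        · rw [lintegral_congr_ae (g := fun _ => 0)]
          · simp
          · filter_upwards [ae_restrict_mem measurableSet_Ioc] with t ht
            refine Set.indicator_of_notMem ?_ _
            rw [Set.mem_ofPred_eq]
            have := ht.2
            intro h; apply hy; linarith
    _ = _ := by
        rw [lintegral_indicator measurableSet_ball, lintegral_const_mul' _ _ ENNReal.coe_ne_top,
          ENNReal.coe_mul, mul_assoc]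

/-- At the single scale `T` no Tonelli argument is needed: the weight `‖h‖^{-n-sr}` is bounded below
on the ball of radius `2T`. -/
theorem exists_modulusOfContinuity_rpow_le_lintegral (hn : 0 < n) (hp : 1 ≤ p) {s r T : ℝ}
    (hs : 0 < s) (hr : 1 ≤ r) (hT : 0 < T) :
    ∃ K : ℝ≥0, ∀ f : Euc n → 𝕜, AEStronglyMeasurable f volume →
      modulusOfContinuity p T f ^ r ≤
      K * ∫⁻ h in ball (0 : Euc n) (2 * T), (ENNReal.ofReal (‖h‖ ^ (-s)) *
        eLpNorm (forwardDiff h f) p volume) ^ r * ENNReal.ofReal (‖h‖ ^ (-(n : ℝ))) := by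
  have hr0 : 0 < r := by linarith
  obtain ⟨K, hK⟩ := exists_modulusOfContinuity_rpow_le (n := n) (𝕜 := 𝕜) hn hp hr
  refine ⟨K * (Real.toNNReal (T ^ (-(n : ℝ))) * Real.toNNReal ((2 * T) ^ ((n : ℝ) + s * r))),
    fun f hf => (hK f hf T hT).trans ?_⟩
  simp only [rpow_mul_weight_norm f _ s hr0]
  rw [ENNReal.coe_mul, ENNReal.coe_mul, mul_assoc, mul_assoc,
    ← lintegral_const_mul' _ _ ENNReal.coe_ne_top]
  refine mul_le_mul_right (mul_le_mul_right (setLIntegral_mono' measurableSet_ball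
    fun y hy => ?_) _) _
  rw [mem_ball_zero_iff] at hy
  rcases eq_or_ne y 0 with rfl | hy0
  · simp [eLpNorm_forwardDiff_zero_rpow f hr0]
  have hy1 : 0 < ‖y‖ := norm_pos_iff.2 hy0
  have h1 : 1 ≤ (2 * T) ^ ((n : ℝ) + s * r) * ‖y‖ ^ (-(n : ℝ) - s * r) := by
    rw [← neg_add', Real.rpow_neg hy1.le, ← div_eq_mul_inv, one_le_div (by positivity)]
    exact Real.rpow_le_rpow hy1.le hy.le (by positivity)
  calc eLpNorm (forwardDiff y f) p volume ^ r
      = eLpNorm (forwardDiff y f) p volume ^ r * ENNReal.ofReal 1 := by simp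
    _ ≤ eLpNorm (forwardDiff y f) p volume ^ r *
        ENNReal.ofReal ((2 * T) ^ ((n : ℝ) + s * r) * ‖y‖ ^ (-(n : ℝ) - s * r)) := by gcongr
    _ = _ := by
      rw [ENNReal.ofReal_mul (by positivity), mul_left_comm]; rfl

/-- Averaging over a ball ignores null sets, so an essential bound on the differences suffices to
control the true supremum. -/
theorem modulusOfContinuity_le_of_essSup (hn : 0 < n) (hp : 1 ≤ p) {s T t : ℝ} (hs : 0 < s)
    (ht : 0 < t) (htT : t ≤ T) {f : Euc n → 𝕜} (hf : AEStronglyMeasurable f volume) :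
    ENNReal.ofReal (t ^ (-s)) * modulusOfContinuity p t f ≤
      (2 * 2 ^ s * 2 ^ (n : ℝ)) * screenedBesovSeminorm (2 * T) s p ⊤ f := by
  simp only [screenedBesovSeminorm, if_true]
  set M := essSup (fun h : Euc n => ENNReal.ofReal (‖h‖ ^ (-s)) *
    eLpNorm (forwardDiff h f) p volume) (volume.restrict (ball 0 (2 * T)))
  have hM : ∀ᵐ y ∂(volume.restrict (ball (0 : Euc n) (2 * t))),
      eLpNorm (forwardDiff y f) p volume ≤ ENNReal.ofReal ((2 * t) ^ s) * M := by
    have h1 : ∀ᵐ y ∂(volume.restrict (ball (0 : Euc n) (2 * t))),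
        ENNReal.ofReal (‖y‖ ^ (-s)) * eLpNorm (forwardDiff y f) p volume ≤ M :=
      ae_mono (Measure.restrict_mono (ball_subset_ball (by linarith)) le_rfl)
        (ENNReal.ae_le_essSup _)
    filter_upwards [h1, ae_restrict_mem measurableSet_ball] with y hy hyt
    rw [mem_ball_zero_iff] at hyt
    rcases eq_or_ne y 0 with rfl | hy0
    · simp [forwardDiff_zero]
    have hy1 : 0 < ‖y‖ := norm_pos_iff.2 hy0
    calc eLpNorm (forwardDiff y f) p volume
        = ENNReal.ofReal (‖y‖ ^ s) *
            (ENNReal.ofReal (‖y‖ ^ (-s)) * eLpNorm (forwardDiff y f) p volume) := by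
          rw [← mul_assoc, ← ENNReal.ofReal_mul (by positivity), ← Real.rpow_add hy1]
          simp
      _ ≤ _ := by gcongr
  set V := volume (ball (0 : Euc n) t)
  have hV0 : V ≠ 0 := (measure_ball_pos volume _ ht).ne'
  have hVt : V ≠ ⊤ := measure_ball_lt_top.ne
  have h2 : V * modulusOfContinuity p t f ≤
      V * (2 * 2 ^ (n : ℝ) * (ENNReal.ofReal ((2 * t) ^ s) * M)) := by
    refine (volume_ball_mul_modulusOfContinuity_le hp hf t).trans ?_
    calc _ ≤ 2 * ∫⁻ _ in ball (0 : Euc n) (2 * t), ENNReal.ofReal ((2 * t) ^ s) * M := by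
          gcongr 2 * ?_
          exact lintegral_mono_ae hM
      _ = _ := by
          rw [setLIntegral_const, volume_ball_two_mul ht.le hn]; ring
  rw [ENNReal.mul_le_mul_iff_right hV0 hVt] at h2
  calc _ ≤ ENNReal.ofReal (t ^ (-s)) * (2 * 2 ^ (n : ℝ) * (ENNReal.ofReal ((2 * t) ^ s) * M)) := by
        gcongr
    _ = ENNReal.ofReal (t ^ (-s)) * ENNReal.ofReal ((2 * t) ^ s) * (2 * 2 ^ (n : ℝ) * M) := by ring
    _ = 2 ^ s * (2 * 2 ^ (n : ℝ) * M) := by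
        rw [← ENNReal.ofReal_mul (by positivity), Real.mul_rpow (by simp) ht.le,
          mul_left_comm (t ^ (-s)), ← Real.rpow_add ht, neg_add_cancel, Real.rpow_zero, mul_one,
          ← ENNReal.ofReal_rpow_of_nonneg (by simp) hs.le, ENNReal.ofReal_ofNat]
    _ = _ := by ring

theorem exists_modulusOfContinuity_le_screened (hn : 0 < n) (hp : 1 ≤ p) (hq : 1 ≤ q) {s T : ℝ}
    (hs : 0 < s) (hT : 0 < T) :
    ∃ K : ℝ≥0, ∀ f : Euc n → 𝕜, AEStronglyMeasurable f volume →
      modulusOfContinuity p T f ≤ K * screenedBesovSeminorm (2 * T) s p q f := by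
  by_cases hqt : q = ⊤
  · subst hqt
    refine ⟨Real.toNNReal (T ^ s) * (2 * 2 ^ s * 2 ^ (n : ℝ)), fun f hf => ?_⟩
    have h := modulusOfContinuity_le_of_essSup hn hp hs hT le_rfl hf
    calc modulusOfContinuity p T f
        = ENNReal.ofReal (T ^ s) * (ENNReal.ofReal (T ^ (-s)) * modulusOfContinuity p T f) := by
          rw [← mul_assoc, ← ENNReal.ofReal_mul (by positivity), ← Real.rpow_add hT]
          simp
      _ ≤ ENNReal.ofReal (T ^ s) * ((2 * 2 ^ s * 2 ^ (n : ℝ)) *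
            screenedBesovSeminorm (2 * T) s p ⊤ f) := by gcongr
      _ = _ := by
          rw [← mul_assoc]
          congr 1
          rw [ENNReal.coe_mul, ENNReal.coe_mul, ENNReal.coe_mul,
            ENNReal.coe_rpow_of_nonneg _ hs.le, ENNReal.coe_rpow_of_nonneg _ (by positivity)]
          rfl
  · have hr := one_le_toReal_of_one_le hq hqt
    have hr0 : 0 < q.toReal := by linarith
    obtain ⟨K, hK⟩ := exists_modulusOfContinuity_rpow_le_lintegral (n := n) (𝕜 := 𝕜) hn hp hs hr hT
    refine ⟨K ^ (1 / q.toReal), fun f hf => ?_⟩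
    simp only [screenedBesovSeminorm, hqt, if_false]
    rw [ENNReal.coe_rpow_of_nonneg _ (by positivity), ← ENNReal.mul_rpow_of_nonneg _ _
      (by positivity), one_div, ENNReal.le_rpow_inv_iff hr0]
    exact hK f hf

/-- The two hypotheses are what the rough part `f₀` satisfies: comparison with `f` at scales up to
`T`, and a uniform bound beyond. The uniform bound is integrable against `t^{-1-sr}` at infinity
because `s > 0`. -/
theorem exists_homogeneousBesovSeminorm_le_screened (hn : 0 < n) (hp : 1 ≤ p) (hq : 1 ≤ q)
    {s T : ℝ} (hs : 0 < s) (hT : 0 < T) (a : ℝ≥0) :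
    ∃ K : ℝ≥0, ∀ f f₀ : Euc n → 𝕜, AEStronglyMeasurable f volume →
      (∀ t, t ≤ T → modulusOfContinuity p t f₀ ≤ a * modulusOfContinuity p t f) →
      (∀ t, modulusOfContinuity p t f₀ ≤ a * modulusOfContinuity p T f) →
      homogeneousBesovSeminorm s p q f₀ ≤ K * screenedBesovSeminorm (2 * T) s p q f := by
  by_cases hqt : q = ⊤
  · subst hqt
    refine ⟨a * (2 * 2 ^ s * 2 ^ (n : ℝ)), fun f f₀ hf h1 h2 => ?_⟩
    have hcoe : ((a * (2 * 2 ^ s * 2 ^ (n : ℝ)) : ℝ≥0) : ℝ≥0∞) =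
        a * (2 * 2 ^ s * 2 ^ (n : ℝ)) := by
      rw [ENNReal.coe_mul, ENNReal.coe_mul, ENNReal.coe_mul,
            ENNReal.coe_rpow_of_nonneg _ hs.le, ENNReal.coe_rpow_of_nonneg _ (by positivity)]
      rfl
    rw [hcoe, mul_assoc]
    rw [homogeneousBesovSeminorm, if_pos rfl]
    refine iSup₂_le fun t ht => ?_
    rw [Set.mem_Ioi] at ht
    rcases le_total t T with htT | hTt
    · calc _ ≤ ENNReal.ofReal (t ^ (-s)) * (a * modulusOfContinuity p t f) := by
            gcongr; exact h1 t htT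
        _ = a * (ENNReal.ofReal (t ^ (-s)) * modulusOfContinuity p t f) := by ring
        _ ≤ _ := by
            gcongr a * ?_
            exact modulusOfContinuity_le_of_essSup hn hp hs ht htT hf
    · calc _ ≤ ENNReal.ofReal (T ^ (-s)) * (a * modulusOfContinuity p T f) := by
            gcongr ENNReal.ofReal ?_ * ?_
            · exact Real.rpow_le_rpow_of_nonpos hT hTt (by linarith)
            · exact h2 t
        _ = a * (ENNReal.ofReal (T ^ (-s)) * modulusOfContinuity p T f) := by ring
        _ ≤ _ := by
            gcongr a * ?_
            exact modulusOfContinuity_le_of_essSup hn hp hs hT le_rfl hf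
  · have hr := one_le_toReal_of_one_le hq hqt
    have hr0 : 0 < q.toReal := by linarith
    obtain ⟨K, hK⟩ := exists_modulusOfContinuity_rpow_le_lintegral (n := n) (𝕜 := 𝕜) hn hp hs hr hT
    obtain ⟨K', hK'⟩ := exists_lintegral_Ioc_modulus_le (n := n) (𝕜 := 𝕜) hn hp hs hr
    set r := q.toReal
    set Q : ℝ≥0∞ := ∫⁻ t in Set.Ioi T, ENNReal.ofReal (t ^ (-1 - s * r)) with hQdef
    have hQ : Q ≠ ⊤ := by
      have : 0 < s * r := by positivity
      rw [hQdef, lintegral_Ioi_rpow (by linarith) hT]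
      exact ENNReal.ofReal_ne_top
    refine ⟨(a ^ r * (K' + K * Q.toNNReal)) ^ (1 / r), fun f f₀ hf h1 h2 => ?_⟩
    simp only [screenedBesovSeminorm, homogeneousBesovSeminorm, hqt, if_false]
    rw [ENNReal.coe_rpow_of_nonneg _ (by positivity), ← ENNReal.mul_rpow_of_nonneg _ _
      (by positivity)]
    refine ENNReal.rpow_le_rpow ?_ (by positivity)
    rw [ENNReal.coe_mul, ENNReal.coe_add, ENNReal.coe_mul, ENNReal.coe_toNNReal hQ,
      ENNReal.coe_rpow_of_nonneg _ hr0.le]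
    set I := ∫⁻ h in ball (0 : Euc n) (2 * T), (ENNReal.ofReal (‖h‖ ^ (-s)) *
        eLpNorm (forwardDiff h f) p volume) ^ r * ENNReal.ofReal (‖h‖ ^ (-(n : ℝ)))
    have har : (a : ℝ≥0∞) ^ r ≠ ⊤ := ENNReal.rpow_ne_top_of_nonneg hr0.le ENNReal.coe_ne_top
    have near : ∫⁻ t in Set.Ioc 0 T, (ENNReal.ofReal (t ^ (-s)) *
        modulusOfContinuity p t f₀) ^ r * ENNReal.ofReal t⁻¹ ≤ a ^ r * (K' * I) := by
      calc _ ≤ ∫⁻ t in Set.Ioc 0 T, a ^ r * ((ENNReal.ofReal (t ^ (-s)) *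
            modulusOfContinuity p t f) ^ r * ENNReal.ofReal t⁻¹) := by
            refine setLIntegral_mono' measurableSet_Ioc fun t ht => ?_
            rw [← mul_assoc, ← ENNReal.mul_rpow_of_nonneg _ _ hr0.le, mul_left_comm]
            gcongr
            exact h1 t ht.2
        _ ≤ _ := by
            rw [lintegral_const_mul' _ _ har]
            gcongr
            exact hK' f hf T
    have far : ∫⁻ t in Set.Ioi T, (ENNReal.ofReal (t ^ (-s)) *
        modulusOfContinuity p t f₀) ^ r * ENNReal.ofReal t⁻¹ ≤ a ^ r * (K * I * Q) := by
      calc _ ≤ ∫⁻ t in Set.Ioi T, (a ^ r * (K * I)) * ENNReal.ofReal (t ^ (-1 - s * r)) := by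
            refine setLIntegral_mono' measurableSet_Ioi fun t ht => ?_
            rw [← Real.rpow_neg_one, rpow_mul_weight _ (hT.trans ht) hr0.le]
            gcongr
            calc modulusOfContinuity p t f₀ ^ r ≤ (a * modulusOfContinuity p T f) ^ r := by
                  gcongr; exact h2 t
              _ ≤ _ := by
                  rw [ENNReal.mul_rpow_of_nonneg _ _ hr0.le]
                  gcongr
                  exact hK f hf
        _ = _ := by
            rw [lintegral_const_mul _ (by fun_prop)]; ring
    calc _ = ∫⁻ t in Set.Ioc 0 T ∪ Set.Ioi T, (ENNReal.ofReal (t ^ (-s)) *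
        modulusOfContinuity p t f₀) ^ r * ENNReal.ofReal t⁻¹ := by
          rw [Set.Ioc_union_Ioi_eq_Ioi hT.le]
      _ ≤ _ := lintegral_union_le _ _ _
      _ ≤ a ^ r * (K' * I) + a ^ r * (K * I * Q) := add_le_add near far
      _ = _ := by ring

end ScreenedToHomogeneous

/-! ### Mollification and the splitting into rough and smooth parts. -/

section Mollification

open scoped Convolution
open ContinuousLinearMap

variable {n : ℕ} {𝕜 : Type*} [RCLike 𝕜] {p : ℝ≥0∞} {k : Euc n → ℝ} {f : Euc n → 𝕜}

/-- The convolution of `f` with a real kernel `k`. -/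
noncomputable def mollify (k : Euc n → ℝ) (f : Euc n → 𝕜) : Euc n → 𝕜 := fun x => ∫ y, k y • f (x - y)

theorem mollify_eq_convolution (k : Euc n → ℝ) (f : Euc n → 𝕜) :
    mollify k f = f ⋆[(lsmul ℝ ℝ).flip, volume] k := by
  rw [convolution_flip]
  rfl

theorem integrable_smul_comp_sub (hk : Continuous k) (hkc : HasCompactSupport k)
    (hf : LocallyIntegrable f volume) (x : Euc n) :
    Integrable (fun y => k y • f (x - y)) volume :=
  hkc.convolutionExists_left (lsmul ℝ ℝ) hk hf x

theorem continuous_mollify (hk : Continuous k) (hkc : HasCompactSupport k)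
    (hf : LocallyIntegrable f volume) : Continuous (mollify k f) := by
  rw [mollify_eq_convolution]
  exact hkc.continuous_convolution_right _ hf hk

theorem hasFDerivAt_mollify (hk : ContDiff ℝ 1 k) (hkc : HasCompactSupport k)
    (hf : LocallyIntegrable f volume) (x : Euc n) :
    HasFDerivAt (mollify k f)
      ((f ⋆[((lsmul ℝ ℝ).flip : 𝕜 →L[ℝ] ℝ →L[ℝ] 𝕜).precompR (Euc n), volume] fderiv ℝ k) x) x := by
  rw [mollify_eq_convolution]
  exact hkc.hasFDerivAt_convolution_right _ hf hk x

theorem fderiv_mollify_apply (hk : ContDiff ℝ 1 k) (hkc : HasCompactSupport k)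
    (hf : LocallyIntegrable f volume) (x v : Euc n) :
    fderiv ℝ (mollify k f) x v = mollify (fun y => fderiv ℝ k y v) f x := by
  rw [(hasFDerivAt_mollify hk hkc hf x).fderiv, convolution_precompR_apply _ hf (hkc.fderiv ℝ)
    (hk.continuous_fderiv one_ne_zero), mollify_eq_convolution]

theorem isWeakPartial_mollify (hk : ContDiff ℝ 1 k) (hkc : HasCompactSupport k)
    (hf : LocallyIntegrable f volume) (j : Fin n) :
    IsWeakPartial j (mollify k f)
      (mollify (fun y => fderiv ℝ k y (EuclideanSpace.single j 1)) f) := by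
  have hk' : Continuous fun y => fderiv ℝ k y (EuclideanSpace.single j 1) := by
    have := hk.continuous_fderiv one_ne_zero
    fun_prop
  have hkc' : HasCompactSupport fun y => fderiv ℝ k y (EuclideanSpace.single j 1) :=
    hkc.fderiv_apply (𝕜 := ℝ) _
  have h1 := (continuous_mollify hk.continuous hkc hf).locallyIntegrable (μ := volume)
  have h2 := (continuous_mollify hk' hkc' hf).locallyIntegrable (μ := volume)
  refine ⟨h1, h2, fun φ hφ hφc => ?_⟩
  have hφ' : Continuous fun x => fderiv ℝ φ x (EuclideanSpace.single j 1) := by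
    have := hφ.continuous_fderiv (by simp)
    fun_prop
  have := integral_bilinear_fderiv_right_eq_neg_left_of_integrable (μ := volume)
    (f := φ) (g := mollify k f) (v := EuclideanSpace.single j 1) (B := lsmul ℝ ℝ)
    (h1.integrable_smul_left_of_hasCompactSupport hφ' (hφc.fderiv_apply (𝕜 := ℝ) _))
    (by simpa only [fderiv_mollify_apply hk hkc hf, lsmul_apply] using
      h2.integrable_smul_left_of_hasCompactSupport hφ.continuous hφc)
    (h1.integrable_smul_left_of_hasCompactSupport hφ.continuous hφc)
    (fun x _ => hφ.differentiable (by simp) x)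
    (fun x _ => (hasFDerivAt_mollify hk hkc hf x).differentiableAt)
  simp only [fderiv_mollify_apply hk hkc hf, lsmul_apply] at this
  rw [this, neg_neg]

theorem integral_fderiv_apply_eq_zero (hk : ContDiff ℝ 1 k) (hkc : HasCompactSupport k)
    (v : Euc n) : ∫ y, fderiv ℝ k y v = 0 := by
  have hk' : Continuous fun y => fderiv ℝ k y v := by
    have := hk.continuous_fderiv one_ne_zero
    fun_prop
  have := integral_mul_fderiv_eq_neg_fderiv_mul_of_integrable (μ := (volume : Measure (Euc n)))
    (f := fun _ => (1 : ℝ)) (g := k) (v := v) (by simp)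
    (by simpa using hk'.integrable_of_hasCompactSupport (hkc.fderiv_apply (𝕜 := ℝ) v))
    (by simpa using hk.continuous.integrable_of_hasCompactSupport hkc)
    (fun x _ => differentiableAt_const _) (fun x _ => hk.differentiable one_ne_zero x)
  simpa using this

/-- Used twice: for a kernel of integral `1` it expresses the mollification error, and for a kernel
of integral `0` the gradient, through differences of `f`. -/
theorem mollify_sub_integral_smul (hk : Continuous k) (hkc : HasCompactSupport k)
    (hf : LocallyIntegrable f volume) (x : Euc n) :
    mollify k f x - (∫ y, k y) • f x = ∫ y, k y • forwardDiff (-y) f x := by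
  rw [mollify, ← integral_smul_const, ← integral_sub (integrable_smul_comp_sub hk hkc hf x)
    ((hk.integrable_of_hasCompactSupport hkc).smul_const _)]
  simp only [forwardDiff, smul_sub, ← sub_eq_add_neg]

theorem forwardDiff_mollify (hk : Continuous k) (hkc : HasCompactSupport k)
    (hf : LocallyIntegrable f volume) (h x : Euc n) :
    forwardDiff h (mollify k f) x = ∫ y, k y • forwardDiff h f (x - y) := by
  rw [forwardDiff, mollify, mollify, ← integral_sub (integrable_smul_comp_sub hk hkc hf _)
    (integrable_smul_comp_sub hk hkc hf _)]
  refine integral_congr_ae (Filter.Eventually.of_forall fun y => ?_)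
  simp only [forwardDiff, smul_sub, sub_add_eq_add_sub]

/-- An `Lᵖ` bound for integrals against a bounded kernel supported in a ball. -/
theorem eLpNorm_integral_smul_le (hp : 1 ≤ p) {w : Euc n → Euc n → 𝕜}
    (hw : Measurable (Function.uncurry w)) {C : ℝ≥0} (hC : ∀ y, ‖k y‖ ≤ C) {T : ℝ}
    (hk : Function.support k ⊆ closedBall 0 T) {K : ℝ≥0∞}
    (hK : ∀ y, ‖y‖ ≤ T → eLpNorm (fun x => w x y) p volume ≤ K) :
    eLpNorm (fun x => ∫ y, k y • w x y) p volume ≤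
      C * volume (closedBall (0 : Euc n) T) * K := by
  have hfin : IsFiniteMeasure (volume.restrict (closedBall (0 : Euc n) T)) :=
    ⟨by simpa using measure_closedBall_lt_top⟩
  -- The kernel bound and its support are absorbed into the finite measure `C • volume.restrict`, so
  -- that `eLpNorm_lintegral_le` applies.
  calc eLpNorm (fun x => ∫ y, k y • w x y) p volume
      ≤ eLpNorm (fun x => ∫⁻ y, ‖w x y‖ₑ ∂(C • volume.restrict (closedBall 0 T))) p volume := by
        refine eLpNorm_mono_enorm fun x => ?_
        rw [enorm_eq_self, ← setIntegral_eq_integral_of_forall_compl_eq_zero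
          (s := closedBall 0 T), lintegral_smul_measure]
        · refine (enorm_integral_le_lintegral_enorm _).trans ?_
          rw [ENNReal.smul_def, smul_eq_mul, ← lintegral_const_mul' _ _ ENNReal.coe_ne_top]
          refine lintegral_mono fun y => ?_
          rw [enorm_smul]
          gcongr
          exact ENNReal.coe_le_coe.2 (hC y)
        · intro y hy
          rw [Function.notMem_support.1 fun h => hy (hk h), zero_smul]
    _ ≤ (C • volume.restrict (closedBall (0 : Euc n) T)) Set.univ * K := by
        refine eLpNorm_lintegral_le hp hw.enorm ?_
        refine Measure.ae_smul_measure ?_ C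
        filter_upwards [ae_restrict_mem measurableSet_closedBall] with y hy
        refine (eLpNorm_enorm _).le.trans (hK y ?_)
        simpa using hy
    _ = _ := by
        rw [Measure.smul_apply, Measure.restrict_apply_univ, ENNReal.smul_def, smul_eq_mul]

/-- Splitting of a function into a rough part and a smooth part at scale `T`. -/
theorem exists_rough_smooth_decomposition (hp : 1 ≤ p) {T : ℝ} (hT : 0 < T) :
    ∃ a : ℝ≥0, ∀ f : Euc n → 𝕜, Measurable f → LocallyIntegrable f volume →
      ∃ (f₀ f₁ : Euc n → 𝕜) (g : Fin n → Euc n → 𝕜), f = f₀ + f₁ ∧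
        LocallyIntegrable f₀ volume ∧ (∀ j, IsWeakPartial j f₁ (g j)) ∧
        (∀ j, eLpNorm (g j) p volume ≤ a * modulusOfContinuity p T f) ∧
        (∀ t, t ≤ T → modulusOfContinuity p t f₀ ≤ a * modulusOfContinuity p t f) ∧
        ∀ t, modulusOfContinuity p t f₀ ≤ a * modulusOfContinuity p T f := by
  -- The outer radius `T` ensures that only differences with shifts of length at most `T` enter.
  let b : ContDiffBump (0 : Euc n) := ⟨T / 2, T, by positivity, by linarith⟩
  set ρ := b.normed volume with hρ
  have hρs : ContDiff ℝ 1 ρ := b.contDiff_normed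
  have hρc : HasCompactSupport ρ := b.hasCompactSupport_normed
  have hρ1 : ∫ y, ρ y = 1 := b.integral_normed
  obtain ⟨C₀, hC₀⟩ := hρs.continuous.bounded_above_of_compact_support hρc
  obtain ⟨C₁, hC₁⟩ := (hρs.continuous_fderiv one_ne_zero).bounded_above_of_compact_support
    (hρc.fderiv ℝ)
  have hρsupp : Function.support ρ ⊆ closedBall 0 T := by
    rw [hρ, b.support_normed_eq]
    exact ball_subset_closedBall
  have hsupp' (j : Fin n) : Function.support (fun y => fderiv ℝ ρ y (EuclideanSpace.single j 1)) ⊆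
      closedBall 0 T := by
    intro y hy
    have h1 : y ∈ tsupport ρ := by
      by_contra h
      exact hy (by simp [image_eq_zero_of_notMem_tsupport
        (fun h' => h (tsupport_fderiv_subset ℝ h'))])
    rwa [hρ, b.tsupport_normed_eq] at h1
  have hC₁' (j : Fin n) (y : Euc n) :
      ‖fderiv ℝ ρ y (EuclideanSpace.single j 1)‖ ≤ C₁.toNNReal := by
    refine (ContinuousLinearMap.le_opNorm _ _).trans ?_
    simpa using (hC₁ y).trans (Real.le_coe_toNNReal C₁)
  have hC₀' (y : Euc n) : ‖ρ y‖ ≤ C₀.toNNReal := (hC₀ y).trans (Real.le_coe_toNNReal C₀)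
  set v : ℝ≥0 := (volume (closedBall (0 : Euc n) T)).toNNReal
  have hv : volume (closedBall (0 : Euc n) T) = v :=
    (ENNReal.coe_toNNReal measure_closedBall_lt_top.ne).symm
  -- One constant for three bounds: `1 + C₀ v` for `t ≤ T`, `2 C₀ v` for arbitrary `t`, and `C₁ v`
  -- for the gradient.
  refine ⟨1 + 2 * (C₀.toNNReal * v) + C₁.toNNReal * v, fun f hf hfl => ?_⟩
  have hdiff : Measurable (Function.uncurry fun x y => forwardDiff (-y) f x) :=
    (hf.comp (by fun_prop : Measurable fun z : Euc n × Euc n => z.1 + -z.2)).sub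
      (hf.comp measurable_fst)
  have hρf : LocallyIntegrable (mollify ρ f) volume :=
    (continuous_mollify hρs.continuous hρc hfl).locallyIntegrable
  have hf₀ : LocallyIntegrable (f - mollify ρ f) volume := hfl.sub hρf
  have hsmall : eLpNorm (f - mollify ρ f) p volume ≤
      C₀.toNNReal * v * modulusOfContinuity p T f := by
    have e : mollify ρ f - f = fun x => ∫ y, ρ y • forwardDiff (-y) f x := by
      ext x
      rw [← mollify_sub_integral_smul hρs.continuous hρc hfl, hρ1, one_smul, Pi.sub_apply]
    rw [eLpNorm_sub_comm, e, ← hv]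
    exact eLpNorm_integral_smul_le hp hdiff hC₀' hρsupp
      fun y hy => eLpNorm_forwardDiff_le_modulus (by simpa using hy)
  have hmoll (t : ℝ) : modulusOfContinuity p t (mollify ρ f) ≤
      C₀.toNNReal * v * modulusOfContinuity p t f := by
    refine modulusOfContinuity_le_iff.2 fun h hh => ?_
    have e : forwardDiff h (mollify ρ f) = fun x => ∫ y, ρ y • forwardDiff h f (x - y) :=
      funext fun x => forwardDiff_mollify hρs.continuous hρc hfl h x
    rw [e, ← hv]
    refine eLpNorm_integral_smul_le hp ?_ hC₀' hρsupp fun y _ => ?_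
    · have hm : Measurable (forwardDiff h f) := (hf.comp (measurable_add_const h)).sub hf
      exact hm.comp (by fun_prop : Measurable fun z : Euc n × Euc n => z.1 - z.2)
    · simp only [sub_eq_add_neg]
      rw [eLpNorm_comp_add_right (aestronglyMeasurable_forwardDiff hf.aestronglyMeasurable h)]
      exact eLpNorm_forwardDiff_le_modulus hh
  refine ⟨f - mollify ρ f, mollify ρ f, fun j => mollify
    (fun y => fderiv ℝ ρ y (EuclideanSpace.single j 1)) f, (sub_add_cancel _ _).symm, hf₀,
    isWeakPartial_mollify hρs hρc hfl, fun j => ?_, fun t _ => ?_, fun t => ?_⟩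
  · have hk' : Continuous fun y => fderiv ℝ ρ y (EuclideanSpace.single j 1) := by
      have := hρs.continuous_fderiv one_ne_zero
      fun_prop
    have e : mollify (fun y => fderiv ℝ ρ y (EuclideanSpace.single j 1)) f =
        fun x => ∫ y, fderiv ℝ ρ y (EuclideanSpace.single j 1) • forwardDiff (-y) f x := by
      ext x
      rw [← mollify_sub_integral_smul hk' (hρc.fderiv_apply (𝕜 := ℝ) _) hfl,
        integral_fderiv_apply_eq_zero hρs hρc, zero_smul, sub_zero]
    dsimp only
    rw [e]
    refine (eLpNorm_integral_smul_le hp hdiff (hC₁' j) (hsupp' j)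
      fun y hy => eLpNorm_forwardDiff_le_modulus (by simpa using hy)).trans ?_
    rw [hv]
    gcongr
    push_cast
    exact le_add_self
  · have hle : modulusOfContinuity p t (f - mollify ρ f) ≤
        modulusOfContinuity p t f + modulusOfContinuity p t (mollify ρ f) := by
      refine modulusOfContinuity_le_iff.2 fun h hh => ?_
      have e : forwardDiff h (f - mollify ρ f) =
          forwardDiff h f - forwardDiff h (mollify ρ f) := by
        ext x
        simp only [forwardDiff, Pi.sub_apply]
        ring
      rw [e]
      exact (eLpNorm_sub_le (aestronglyMeasurable_forwardDiff hf.aestronglyMeasurable h)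
        (aestronglyMeasurable_forwardDiff hρf.aestronglyMeasurable h) hp).trans
        (add_le_add (eLpNorm_forwardDiff_le_modulus hh) (eLpNorm_forwardDiff_le_modulus hh))
    refine (hle.trans (add_le_add le_rfl (hmoll t))).trans ?_
    push_cast
    calc _ = (1 + (C₀.toNNReal : ℝ≥0∞) * v) * modulusOfContinuity p t f := by ring
      _ ≤ _ := by
        refine mul_le_mul_left ?_ _
        refine le_add_right (add_le_add le_rfl ?_)
        rw [two_mul]
        exact le_self_add
  -- At arbitrary shifts the difference of `f₀` is at most twice its `L^p` norm, itself controlled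
  -- by `ω_p(T, f)`.
  · refine modulusOfContinuity_le_iff.2 fun h _ => ?_
    refine (eLpNorm_forwardDiff_le_two_mul hp hf₀.aestronglyMeasurable h).trans ?_
    push_cast
    calc _ ≤ 2 * (C₀.toNNReal * v * modulusOfContinuity p T f) := by gcongr
      _ = (2 * ((C₀.toNNReal : ℝ≥0∞) * v)) * modulusOfContinuity p T f := by ring
      _ ≤ _ := by
        gcongr
        exact le_add_right le_add_self

end Mollification

/-! ### Equivalence of seminormed spaces and a sandwich principle. -/

namespace FunctionSpace

variable {n : ℕ} {𝕜 : Type*} [RCLike 𝕜]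

theorem Equivalent.symm {X Y : FunctionSpace n 𝕜} (h : X.Equivalent Y) : Y.Equivalent X := by
  obtain ⟨hc, C, hC, hle⟩ := h
  exact ⟨hc.symm, C, hC, fun f hf => (hle f (hc ▸ hf)).symm⟩

theorem Equivalent.of_le_of_le {N₁ N N₂ : (Euc n → 𝕜) → ℝ≥0∞} {S : FunctionSpace n 𝕜}
    (h₁ : ∀ f, LocallyIntegrable f volume → N₁ f ≤ N f)
    (h₂ : ∀ f, LocallyIntegrable f volume → N f ≤ N₂ f)
    (hS₁ : (ofSeminorm N₁).Equivalent S) (hS₂ : (ofSeminorm N₂).Equivalent S) :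
    (ofSeminorm N).Equivalent S := by
  obtain ⟨hc₁, C₁, hC₁, hle₁⟩ := hS₁
  obtain ⟨hc₂, C₂, hC₂, hle₂⟩ := hS₂
  have hsub : ∀ f ∈ (ofSeminorm N).carrier, f ∈ (ofSeminorm N₁).carrier :=
    fun f hf => ⟨hf.1, (h₁ f hf.1).trans_lt hf.2⟩
  have hsub' : ∀ f ∈ (ofSeminorm N₂).carrier, f ∈ (ofSeminorm N).carrier :=
    fun f hf => ⟨hf.1, (h₂ f hf.1).trans_lt hf.2⟩
  refine ⟨Set.Subset.antisymm (fun f hf => hc₁ ▸ hsub f hf) (fun f hf => hsub' f (hc₂ ▸ hf)),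
    max C₁ C₂, lt_max_of_lt_left hC₁, fun f hf => ?_⟩
  have hf₁ := hsub f hf
  have hf₂ : f ∈ (ofSeminorm N₂).carrier := by rw [hc₂, ← hc₁]; exact hf₁
  have a : N f ≤ C₂ * S.seminorm f := (h₂ f hf.1).trans (hle₂ f hf₂).1
  have b : S.seminorm f ≤ C₁ * N f :=
    (hle₁ f hf₁).2.trans (mul_le_mul_right (h₁ f hf.1) _)
  refine ⟨a.trans ?_, b.trans ?_⟩
  · gcongr
    exact le_max_right _ _
  · change C₁ * N f ≤ _ * N f
    gcongr
    exact le_max_left _ _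

end FunctionSpace

/-! ### Assembly of the equivalences. -/

section Main

variable {n : ℕ} {𝕜 : Type*} [RCLike 𝕜] {p q : ℝ≥0∞}

theorem screenedBesovSeminorm_congr {σ s : ℝ} {f g : Euc n → 𝕜} (hfg : f =ᵐ[volume] g) :
    screenedBesovSeminorm σ s p q f = screenedBesovSeminorm σ s p q g := by
  simp only [screenedBesovSeminorm, eLpNorm_forwardDiff_congr _ hfg]

theorem eLpNorm_forwardDiff_le_homogeneousSobolev (hp : 1 ≤ p) (h : Euc n) {f : Euc n → 𝕜}
    (hf : LocallyIntegrable f volume) :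
    eLpNorm (forwardDiff h f) p volume ≤
      ENNReal.ofReal ‖h‖ * homogeneousSobolevSeminorm p f := by
  -- The factor `‖h‖` is moved inside the infimum over families of weak derivatives, for which it
  -- must be nonzero.
  rcases eq_or_ne h 0 with rfl | h0
  · simp [forwardDiff_zero]
  have h1 : ENNReal.ofReal ‖h‖ ≠ 0 := by simpa using h0
  simp only [homogeneousSobolevSeminorm, ENNReal.mul_iInf_of_ne h1 ENNReal.ofReal_ne_top]
  exact le_iInf₂ fun g hg => eLpNorm_forwardDiff_le_of_isWeakPartial hp h hf hg

theorem exists_screenedBesovSeminorm_le_of_add (hn : 0 < n) {σ s : ℝ}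
    (hs : s ∈ Set.Ioo (0 : ℝ) 1) (hp : 1 ≤ p) (hq : 1 ≤ q) :
    ∃ C : ℝ≥0, ∀ f f₀ f₁ : Euc n → 𝕜, LocallyIntegrable f₀ volume →
      LocallyIntegrable f₁ volume → f =ᵐ[volume] f₀ + f₁ →
      screenedBesovSeminorm σ s p q f ≤
        C * (homogeneousBesovSeminorm s p q f₀ + homogeneousSobolevSeminorm p f₁) := by
  obtain ⟨C, hC⟩ := exists_screenedBesovSeminorm_le (n := n) (𝕜 := 𝕜) (σ := σ) hn hs p hq
  refine ⟨C, fun f f₀ f₁ h₀ h₁ hf => hC f f₀ _ fun h => ?_⟩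
  rw [eLpNorm_forwardDiff_congr h hf]
  have e : forwardDiff h (f₀ + f₁) = forwardDiff h f₀ + forwardDiff h f₁ := by
    ext x
    simp only [forwardDiff, Pi.add_apply]
    ring
  rw [e]
  exact (eLpNorm_add_le (aestronglyMeasurable_forwardDiff h₀.aestronglyMeasurable h)
    (aestronglyMeasurable_forwardDiff h₁.aestronglyMeasurable h) hp).trans
    (add_le_add (eLpNorm_forwardDiff_le_modulus le_rfl)
      (eLpNorm_forwardDiff_le_homogeneousSobolev hp h h₁))

theorem exists_decomposition_of_screenedBesov (hn : 0 < n) {σ s : ℝ} (hσ : 0 < σ)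
    (hs : s ∈ Set.Ioo (0 : ℝ) 1) (hp : 1 ≤ p) (hq : 1 ≤ q) :
    ∃ C : ℝ≥0, ∀ f ∈ (screenedBesov n 𝕜 σ s p q).carrier,
      ∃ f₀ ∈ (homogeneousBesov n 𝕜 s p q).carrier, ∃ f₁ ∈ (homogeneousSobolev n 𝕜 p).carrier,
        f =ᵐ[volume] f₀ + f₁ ∧
        homogeneousBesovSeminorm s p q f₀ + homogeneousSobolevSeminorm p f₁ ≤
          C * screenedBesovSeminorm σ s p q f := by
  -- Half the radius, because the averaging estimate at scale `T` uses shifts up to `2T`.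
  have hT : 0 < σ / 2 := by positivity
  obtain ⟨a, ha⟩ := exists_rough_smooth_decomposition (n := n) (𝕜 := 𝕜) hp hT
  obtain ⟨K, hK⟩ := exists_modulusOfContinuity_le_screened (n := n) (𝕜 := 𝕜) hn hp hq hs.1 hT
  obtain ⟨L, hL⟩ := exists_homogeneousBesovSeminorm_le_screened (n := n) (𝕜 := 𝕜) hn hp hq hs.1
    hT a
  simp only [mul_div_cancel₀ σ two_ne_zero] at hK hL
  refine ⟨L + n * (a * K), fun f hf => ?_⟩
  obtain ⟨hfl, hfN⟩ := hf
  change screenedBesovSeminorm σ s p q f < ⊤ at hfN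
  have hmk := hfl.aestronglyMeasurable.ae_eq_mk
  set f' := hfl.aestronglyMeasurable.mk f with hf'
  have hf'm : StronglyMeasurable f' := hfl.aestronglyMeasurable.stronglyMeasurable_mk
  rw [screenedBesovSeminorm_congr hmk] at hfN ⊢
  obtain ⟨f₀, f₁, g, hsum, h₀, hg, hgN, hω, hω'⟩ := ha f' hf'm.measurable (hfl.congr hmk)
  have hgK (j : Fin n) : eLpNorm (g j) p volume ≤ a * K * screenedBesovSeminorm σ s p q f' := by
    refine (hgN j).trans ?_
    rw [mul_assoc]
    gcongr
    exact hK f' hf'm.aestronglyMeasurable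
  have hB := hL f' f₀ hf'm.aestronglyMeasurable hω hω'
  -- Local integrability of `f₁` is read off from its weak partial derivative of index `0`, which
  -- exists since `n > 0`.
  refine ⟨f₀, ⟨h₀, hB.trans_lt (ENNReal.mul_lt_top ENNReal.coe_lt_top hfN)⟩, f₁,
    ⟨(hg ⟨0, hn⟩).1, fun j => ⟨g j, hg j, (hg j).2.1.aestronglyMeasurable,
      (hgK j).trans_lt (ENNReal.mul_lt_top (by finiteness) hfN)⟩⟩, hsum ▸ hmk, ?_⟩
  calc _ ≤ L * screenedBesovSeminorm σ s p q f' +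
        ∑ _ : Fin n, a * K * screenedBesovSeminorm σ s p q f' :=
        add_le_add hB ((iInf₂_le g hg).trans (Finset.sum_le_sum fun j _ => hgK j))
    _ = _ := by
      simp
      ring

theorem screenedBesov_equivalent_sum (hn : 0 < n) {σ s : ℝ} (hσ : 0 < σ)
    (hs : s ∈ Set.Ioo (0 : ℝ) 1) (hp : 1 ≤ p) (hq : 1 ≤ q) :
    (screenedBesov n 𝕜 σ s p q).Equivalent
      ((homogeneousBesov n 𝕜 s p q).sum (homogeneousSobolev n 𝕜 p)) := by
  obtain ⟨C₁, h₁⟩ := exists_screenedBesovSeminorm_le_of_add (n := n) (𝕜 := 𝕜) (σ := σ) hn hs hp hq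
  obtain ⟨C₂, h₂⟩ := exists_decomposition_of_screenedBesov (n := n) (𝕜 := 𝕜) hn hσ hs hp hq
  -- The summand `1` makes the constant nonzero, so that it can be moved inside the infimum defining
  -- the sum seminorm.
  refine ⟨Set.Subset.antisymm (fun f hf => ?_) ?_, C₁ + C₂ + 1, by positivity, fun f hf => ⟨?_, ?_⟩⟩
  · obtain ⟨f₀, hf₀, f₁, hf₁, hsum, -⟩ := h₂ f hf
    exact ⟨f₀, hf₀, f₁, hf₁, hsum⟩
  · rintro f ⟨f₀, hf₀, f₁, hf₁, hsum⟩
    refine ⟨(hf₀.1.add hf₁.1).congr hsum.symm, (h₁ f f₀ f₁ hf₀.1 hf₁.1 hsum).trans_lt ?_⟩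
    choose g hg hgp using hf₁.2
    have hS : homogeneousSobolevSeminorm p f₁ < ⊤ :=
      (iInf₂_le g hg).trans_lt (ENNReal.sum_lt_top.2 fun j _ => (hgp j).2)
    exact ENNReal.mul_lt_top ENNReal.coe_lt_top (ENNReal.add_lt_top.2 ⟨hf₀.2, hS⟩)
  · have hC : ((C₁ + C₂ + 1 : ℝ≥0) : ℝ≥0∞) ≠ 0 := by simp
    simp only [FunctionSpace.sum, ENNReal.mul_iInf_of_ne hC ENNReal.coe_ne_top]
    refine le_iInf₂ fun f₀ hf₀ => le_iInf₂ fun f₁ hf₁ => le_iInf fun hsum => ?_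
    refine (h₁ f f₀ f₁ hf₀.1 hf₁.1 hsum).trans ?_
    refine mul_le_mul_left (ENNReal.coe_le_coe.2 ?_) _
    rw [add_assoc]
    exact le_self_add
  · obtain ⟨f₀, hf₀, f₁, hf₁, hsum, hle⟩ := h₂ f hf
    refine (iInf₂_le_of_le f₀ hf₀ (iInf₂_le_of_le f₁ hf₁ (iInf_le_of_le hsum hle))).trans ?_
    refine mul_le_mul_left (ENNReal.coe_le_coe.2 ?_) _
    rw [add_right_comm]
    exact le_add_self

theorem screenedSobolevSeminorm_mono {σ τ : Euc n → ℝ} (hστ : ∀ x, σ x ≤ τ x) {s r : ℝ}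
    (hr : 0 ≤ r) (f : Euc n → 𝕜) :
    screenedSobolevSeminorm σ s r f ≤ screenedSobolevSeminorm τ s r f := by
  refine ENNReal.rpow_le_rpow (lintegral_mono fun x => ?_) (by positivity)
  exact lintegral_mono_set (ball_subset_ball (hστ x))

theorem screenedSobolevSeminorm_congr {σ : Euc n → ℝ} {s r : ℝ} {f g : Euc n → 𝕜}
    (hfg : f =ᵐ[volume] g) :
    screenedSobolevSeminorm σ s r f = screenedSobolevSeminorm σ s r g := by
  unfold screenedSobolevSeminorm
  congr 1
  refine lintegral_congr_ae (hfg.mono fun x hx => ?_)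
  refine lintegral_congr_ae ((ae_restrict_of_ae hfg).mono fun y hy => ?_)
  simp only [hx, hy]

/-- For a constant screening function, the screened Sobolev and Besov seminorms agree. -/
theorem screenedSobolevSeminorm_const (hp : 1 ≤ p) (hpt : p ≠ ⊤) (σ s : ℝ) {f : Euc n → 𝕜}
    (hf : AEStronglyMeasurable f volume) :
    screenedSobolevSeminorm (fun _ => σ) s p.toReal f = screenedBesovSeminorm σ s p p f := by
  have hr := one_le_toReal_of_one_le hp hpt
  have hr0 : 0 < p.toReal := by linarith
  have hp0 : p ≠ 0 := (zero_lt_one.trans_le hp).ne'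
  rw [screenedSobolevSeminorm_congr hf.ae_eq_mk, screenedBesovSeminorm_congr hf.ae_eq_mk]
  have hm := hf.stronglyMeasurable_mk.measurable
  set f' := hf.mk f
  simp only [screenedSobolevSeminorm, screenedBesovSeminorm, hpt, if_false,
    rpow_mul_weight_norm _ _ _ hr0]
  congr 1
  -- After substituting `y = x + h`, the domain of `h` no longer depends on `x`, so Tonelli applies
  -- to a product. This needs `σ` constant.
  have inner (x : Euc n) : ∫⁻ y in ball x σ,
      ENNReal.ofReal (‖f' x - f' y‖ ^ p.toReal * ‖x - y‖ ^ (-(n : ℝ) - s * p.toReal)) =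
      ∫⁻ h in ball 0 σ, ‖forwardDiff h f' x‖ₑ ^ p.toReal *
        ENNReal.ofReal (‖h‖ ^ (-(n : ℝ) - s * p.toReal)) := by
    rw [← lintegral_indicator measurableSet_ball, ← lintegral_indicator measurableSet_ball,
      ← lintegral_add_left_eq_self _ x]
    refine lintegral_congr fun h => ?_
    by_cases hh : ‖h‖ < σ
    · rw [Set.indicator_of_mem (by simpa using hh), Set.indicator_of_mem (by simpa using hh),
        ENNReal.ofReal_mul (by positivity), ← ENNReal.ofReal_rpow_of_nonneg (by positivity) hr0.le,
        norm_sub_rev, norm_sub_rev x, ofReal_norm, add_sub_cancel_left]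
      rfl
    · rw [Set.indicator_of_notMem (by simpa using hh), Set.indicator_of_notMem (by simpa using hh)]
  simp only [inner]
  rw [lintegral_lintegral_swap]
  · refine lintegral_congr fun h => ?_
    have hmh : Measurable (forwardDiff h f') := (hm.comp (measurable_add_const h)).sub hm
    rw [lintegral_mul_const _ (hmh.enorm.pow_const _),
      eLpNorm_eq_lintegral_rpow_enorm_toReal hp0 hpt, ← ENNReal.rpow_mul,
      one_div_mul_cancel hr0.ne', ENNReal.rpow_one]
  · have hmj : Measurable fun z : Euc n × Euc n => forwardDiff z.2 f' z.1 :=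
      (hm.comp (measurable_fst.add measurable_snd)).sub (hm.comp measurable_fst)
    have h1 := hmj.enorm.pow_const p.toReal
    have h2 : Measurable fun z : Euc n × Euc n =>
      ENNReal.ofReal (‖z.2‖ ^ (-(n : ℝ) - s * p.toReal)) := by fun_prop
    exact (h1.mul h2).aemeasurable

/-- The seminorm is monotone in the screening function and `e^{-M} ≤ σ ≤ e^M`. Both constant
screenings are equivalent to the same sum space, which forces equivalence in between. -/
theorem screenedSobolev_equivalent_sum (hn : 0 < n) {s : ℝ} (hs : s ∈ Set.Ioo (0 : ℝ) 1)
    (hp : 1 ≤ p) (hpt : p ≠ ⊤) {σ : Euc n → ℝ} (hσ : ∀ x, 0 < σ x) {M : ℝ}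
    (hM : ∀ x, |Real.log (σ x)| ≤ M) :
    (screenedSobolev n 𝕜 σ s p.toReal).Equivalent
      ((homogeneousBesov n 𝕜 s p p).sum (homogeneousSobolev n 𝕜 p)) := by
  refine FunctionSpace.Equivalent.of_le_of_le (fun f hf => ?_) (fun f hf => ?_)
    (screenedBesov_equivalent_sum hn (Real.exp_pos (-M)) hs hp hp)
    (screenedBesov_equivalent_sum hn (Real.exp_pos M) hs hp hp)
  · rw [← screenedSobolevSeminorm_const hp hpt _ _ hf.aestronglyMeasurable]
    refine screenedSobolevSeminorm_mono (fun x => ?_) ENNReal.toReal_nonneg f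
    exact (Real.le_log_iff_exp_le (hσ x)).1 (abs_le.1 (hM x)).1
  · rw [← screenedSobolevSeminorm_const hp hpt _ _ hf.aestronglyMeasurable]
    refine screenedSobolevSeminorm_mono (fun x => ?_) ENNReal.toReal_nonneg f
    exact (Real.log_le_iff_le_exp (hσ x)).1 (abs_le.1 (hM x)).2

end Main

theorem mainTheorem1 (n : ℕ) (hn : 0 < n) (𝕜 : Type*) [RCLike 𝕜]
    (s : ℝ) (hs : s ∈ Set.Ioo (0 : ℝ) 1)
    (p q : ℝ≥0∞) (hp : 1 ≤ p) (hq : 1 ≤ q) :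
    (∀ σ τ : ℝ, 0 < σ → 0 < τ →
      (screenedBesov n 𝕜 σ s p q).Equivalent
          ((homogeneousBesov n 𝕜 s p q).sum (homogeneousSobolev n 𝕜 p)) ∧
        ((homogeneousBesov n 𝕜 s p q).sum (homogeneousSobolev n 𝕜 p)).Equivalent
          (screenedBesov n 𝕜 τ s p q)) ∧
    (p < ⊤ → ∀ σ : EuclideanSpace ℝ (Fin n) → ℝ, IsScreening σ →
      (∃ M : ℝ, ∀ x, |Real.log (σ x)| ≤ M) →
      (screenedSobolev n 𝕜 σ s p.toReal).Equivalent
          ((homogeneousBesov n 𝕜 s p p).sum (homogeneousSobolev n 𝕜 p)) ∧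
        ((homogeneousBesov n 𝕜 s p p).sum (homogeneousSobolev n 𝕜 p)).Equivalent
          (screenedBesov n 𝕜 1 s p p)) := by
  refine ⟨fun σ τ hσ hτ => ⟨screenedBesov_equivalent_sum hn hσ hs hp hq,
    (screenedBesov_equivalent_sum hn hτ hs hp hq).symm⟩, fun hpt σ hσ hM => ?_⟩
  obtain ⟨M, hM⟩ := hM
  exact ⟨screenedSobolev_equivalent_sum hn hs hp hpt.ne hσ.pos hM,
    (screenedBesov_equivalent_sum hn one_pos hs hp hp).symm⟩
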